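/- Let $d\ge 2$. Let $w(x)=|x|^{2-d}$ if $d\ge3$ and $w(x)=-\log|x|$ if $d=2$ (we also write $w(r)$ for the value of $w$ at $|x|=r$), and let $c_d$ be the constant with $-\Delta w=c_d\delta_0$, i.e. $c_2=2\pi$ and $c_d=(d-2)|\mathbb S^{d-1}|$ for $d\ge 3$. Write $D(f,g)=\iint w(x-y)f(x)g(y)\,dx\,dy$. Let $\rho:\mathbb R^d\to[0,\infty)$ be radial, integrable with $\int\rho=1$, supported in the unit ball, and of finite self-energy $D(\rho,\rho)$. For $\eta>0$ put $\delta_0^{(\eta)}(x)=\eta^{-d}\rho(x/\eta)$ and $f_\eta=w*\delta_0^{(\eta)}-w$, which vanishes outside $B(0,\eta)$. Put $\kappa_d=c_dD(\rho,\rho)$ for $d\ge 3$, $\kappa_2=c_2$, and $\gamma_2=c_2D(\rho,\rho)$ for $d=2$. Let $\overline{\mathcal A}_1$ be the class of vector fields $\mathbf E=\nabla h$ on $\mathbb R^d$ with $$-\Delta h=c_d\Big(\sum_{p\in\Lambda}N_p\delta_p-1\Big)\quad\text{in }\mathbb R^d$$ in the sense of distributions, for some set $\Lambda\subset\mathbb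 R^d$ with finitely many points in each bounded set and some integers $N_p\ge1$. For $\mathbf E\in\overline{\mathcal A}_1$ and $\eta>0$ let $\mathbf E_\eta=\mathbf E+\sum_{p\in\Lambda}N_p\nabla f_\eta(\cdot-p)$ and, with $K_R=[-R,R]^d$, $$\mathcal W_\eta(\mathbf E)=\limsup_{R\to\infty}\frac1{|K_R|}\int_{K_R}|\mathbf E_\eta|^2-\big(\kappa_d\,w(\eta)+\gamma_2\mathbf 1_{d=2}\big)\in(-\infty,+\infty].$$ Then $\mathcal W_\eta$ is bounded below on $\overline{\mathcal A}_1$ by a constant depending only on the dimension: there is a constant $C=C(d)$ such that $\mathcal W_\eta(\mathbf E)\ge -C$ for every such $\rho$, every $\eta>0$ and every $\mathbf E\in\overline{\mathcal A}_1$. -/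

import Mathlib

open MeasureTheory Filter

noncomputable section

/-- Physical space `ℝ^d` with its Euclidean norm. -/
abbrev Space (d : ℕ) : Type := EuclideanSpace ℝ (Fin d)

/-- The radial profile of the Coulomb kernel: `-log r` if `d = 2` and `1 / r ^ (d - 2)` if `d ≥ 3`.
It is only used for `d ≥ 2`; its value at `r = 0` plays no role. -/
def coulombProfile (d : ℕ) (r : ℝ) : ℝ :=
  if d = 2 then -Real.log r else 1 / r ^ (d - 2)

/-- The Coulomb kernel `w` on `ℝ^d`. -/
def coulombKernel (d : ℕ) (x : Space d) : ℝ := coulombProfile d ‖x‖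

/-- The constant `c_d` in `-Δ w = c_d δ₀`: `c_2 = 2π` and `c_d = (d - 2) |𝕊^{d-1}|` for `d ≥ 3`. -/
def coulombConst (d : ℕ) : ℝ :=
  if d = 2 then 2 * Real.pi
  else ((d : ℝ) - 2) * (volume : Measure (Space d)).toSphere.real Set.univ

/-- The Coulomb interaction `D(f, g) = ∬ w(x - y) f(x) g(y) dx dy` of two charge densities. -/
def coulombInteraction (d : ℕ) (f g : Space d → ℝ) : ℝ :=
  ∫ z : Space d × Space d, coulombKernel d (z.1 - z.2) * (f z.1 * g z.2)

/-- A smearing profile: a radial nonnegative function with integral `1`, supported in the unit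
ball, whose Coulomb self-energy `D(ρ, ρ)` is finite. -/
structure IsSmearingProfile {d : ℕ} (ρ : Space d → ℝ) : Prop where
  radial : ∀ x y, ‖x‖ = ‖y‖ → ρ x = ρ y
  nonneg : ∀ x, 0 ≤ ρ x
  support_subset : Function.support ρ ⊆ Metric.closedBall 0 1
  integrable : Integrable ρ
  integral_eq_one : ∫ x, ρ x = 1
  finite_self_energy :
    Integrable (fun z : Space d × Space d => coulombKernel d (z.1 - z.2) * (ρ z.1 * ρ z.2))

/-- The smeared unit charge at the origin, `δ₀^{(η)}(x) = η^{-d} ρ(x / η)`. -/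
def smearedCharge {d : ℕ} (ρ : Space d → ℝ) (η : ℝ) (x : Space d) : ℝ :=
  (η ^ d)⁻¹ * ρ (η⁻¹ • x)

/-- `κ_d = c_d D(δ₀^{(1)}, δ₀^{(1)})` for `d ≥ 3`, and `κ_2 = c_2`. -/
def kappa {d : ℕ} (ρ : Space d → ℝ) : ℝ :=
  if d = 2 then coulombConst d
  else coulombConst d * coulombInteraction d (smearedCharge ρ 1) (smearedCharge ρ 1)

/-- `γ_2 𝟙_{d = 2}`, where `γ_2 = c_2 D(δ₀^{(1)}, δ₀^{(1)})`. -/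
def gammaTwo {d : ℕ} (ρ : Space d → ℝ) : ℝ :=
  if d = 2 then
    coulombConst d * coulombInteraction d (smearedCharge ρ 1) (smearedCharge ρ 1)
  else 0

/-- Smooth compactly supported test functions on `ℝ^d`. -/
def IsTestFunction {d : ℕ} (φ : Space d → ℝ) : Prop :=
  ContDiff ℝ ((⊤ : ℕ∞) : WithTop ℕ∞) φ ∧ HasCompactSupport φ

/-- `E = ∇h` in the sense of distributions on `ℝ^d`. -/
def IsWeakGradient {d : ℕ} (h : Space d → ℝ) (E : Space d → Space d) : Prop :=
  ∀ φ : Space d → ℝ, IsTestFunction φ →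
    ∫ x, h x • gradient φ x = -∫ x, φ x • E x

/-- `-Δh = c_d (∑_p N_p δ_p - m)` in the sense of distributions on `ℝ^d`. -/
def IsJelliumPotential {d : ℕ} (m : ℝ) (N : Space d → ℕ) (h : Space d → ℝ) : Prop :=
  ∀ φ : Space d → ℝ, IsTestFunction φ →
    -∫ x, h x * Laplacian.laplacian φ x =
      coulombConst d * ((∑ᶠ p : Space d, (N p : ℝ) * φ p) - m * ∫ x, φ x)

/-- The vector field `E` belongs to the class `𝒜̄_m`, with charges `∑_{p ∈ Λ} N_p δ_p`.
The points and their multiplicities are encoded in one function `N`: the set `Λ` is the support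
`{p | N p ≠ 0}` of `N`. It is discrete in the sense that it has finitely many points in every
bounded set. The charges are determined by `E`. -/
def IsAdmissibleField {d : ℕ} (m : ℝ) (E : Space d → Space d) (N : Space d → ℕ) : Prop :=
  (∀ R : ℝ, (Function.support N ∩ Metric.closedBall 0 R).Finite) ∧
  LocallyIntegrable E ∧
  ∃ h : Space d → ℝ, LocallyIntegrable h ∧ IsWeakGradient h E ∧ IsJelliumPotential m N h

/-- The radial function `f_η = w * δ₀^{(η)} - w`, which solves `-Δ f_η = c_d (δ₀^{(η)} - δ₀)` and
vanishes outside `B(0, η)`. -/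
def smearingPotential {d : ℕ} (ρ : Space d → ℝ) (η : ℝ) (x : Space d) : ℝ :=
  (∫ y, coulombKernel d (x - y) * smearedCharge ρ η y) - coulombKernel d x

/-- The smeared field `E_η = E + ∑_p N_p ∇f_η(· - p)`. The function `f_η` is continuously
differentiable away from the origin, and at each `x` only finitely many terms do not vanish. -/
def smearedField {d : ℕ} (ρ : Space d → ℝ) (η : ℝ) (E : Space d → Space d) (N : Space d → ℕ)
    (x : Space d) : Space d :=
  E x + ∑ᶠ p : Space d, (N p : ℝ) • gradient (smearingPotential ρ η) (x - p)

/-- The cube `K_R = [-R, R]^d`. -/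
def cube (d : ℕ) (R : ℝ) : Set (Space d) := {x | ∀ i, |x i| ≤ R}

/-- The smeared jellium energy
`𝒲_η(E) = limsup_{R → ∞} |K_R|⁻¹ ∫_{K_R} |E_η|² - m (κ_d w(η) + γ_2 𝟙_{d = 2})`,
which may be `+∞`. -/
def smearedEnergy {d : ℕ} (ρ : Space d → ℝ) (η m : ℝ) (E : Space d → Space d)
    (N : Space d → ℕ) : EReal :=
  ((limsup (fun R : ℝ =>
      (∫⁻ x in cube d R, ‖smearedField ρ η E N x‖ₑ ^ 2) / volume (cube d R)) atTop : ENNReal) :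
    EReal)
  - ((m * (kappa ρ * coulombProfile d η + gammaTwo ρ) : ℝ) : EReal)

end

/-! Write `μ` for the smeared unit charge `δ₀^{(η)}`. The subtracted constant `κ_d w(η) + γ_2
𝟙_{d=2}` is exactly `c_d D(μ, μ)` (`coulombConst_mul_interaction`). So it suffices that the energy
per unit volume is at least `K = c_d (D(μ, μ) - C)` with `C` depending only on `d`
(`limsup_energy_ge`). This follows from two facts: each charge costs at least `K`, and there is
asymptotically at least one charge per unit volume unless the energy density already exceeds `K`.

Cost of a charge (`charge_mul_le_energy`). The smeared field satisfies `div E_η = c_d (1 - ∑ N_p μ(·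
- p))`, so for every nonnegative test function `φ` supported in the cube, `∫ |E_η|² ≥ 2 ∫ ∇φ · E_η -
∫ |∇φ|²` bounds the energy by explicit integrals of `φ` (`test_le_energy`). Take `φ = ∑ N_p g(· -
p)`, where `g` is the potential of `μ` truncated at the level `w(1)`. By Newton's theorem `w * μ ≤
w`, so `g` lives in the unit ball and `∫ g` is bounded by a dimensional constant, whatever `ρ` and
`η` are. Truncation preserves `-Δg ≤ c_d μ`, which bounds `∫ |∇φ|²` by half of the charge term. What
is left is at least `c_d ∑ N_p (∫ μ g - 2 ∫ g)`: the interactions between distinct charges are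
nonnegative and are dropped, and `N_p² ≥ N_p`. Finally `∫ μ g` is `D(μ, μ)` up to a constant. Only
charges well inside the cube are used, so no screening or boundary correction is needed.

Since `ρ` is merely integrable, `g` is built from a mollification `χ * μ`. The mollification is
recovered on the field side by averaging over translates of the test function with weight `χ`.

Number of charges (`charge_number_ge`). Testing the divergence equation against a cutoff `φ(·/R)`
shows that the charge in the cube equals its volume up to an error `O(1/R)` times volume plus
energy. -/

noncomputable section

/-! ### Polar coordinates. -/

/-- The unit sphere measure. -/
abbrev sphereMeasure (d : ℕ) : Measure (Metric.sphere (0 : Space d) 1) :=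
  (volume : Measure (Space d)).toSphere

/-- The measure `r ^ (d - 1) dr` on `(0, ∞)`. -/
def radialMeasure (d : ℕ) : Measure ℝ :=
  (volume.restrict (Set.Ioi 0)).withDensity fun r ↦ ENNReal.ofReal (r ^ (d - 1))

lemma map_volumeIoiPow (n : ℕ) :
    (Measure.volumeIoiPow n).map Subtype.val =
      (volume.restrict (Set.Ioi (0 : ℝ))).withDensity fun r ↦ ENNReal.ofReal (r ^ n) := by
  have hm : Measurable fun r : ℝ ↦ ENNReal.ofReal (r ^ n) := by fun_prop
  ext s hs
  rw [Measure.map_apply measurable_subtype_coe hs, Measure.volumeIoiPow,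
    withDensity_apply _ (measurable_subtype_coe hs), withDensity_apply _ hs,
    Measure.restrict_restrict hs, setLIntegral_subtype measurableSet_Ioi _
      (fun r : ℝ ↦ ENNReal.ofReal (r ^ n)), Subtype.image_preimage_coe, Set.inter_comm]

/-- The polar homeomorphism lives on the punctured space and on a subtype of radii. The origin is a
null set, so both subtypes can be removed. -/
lemma measurePreserving_polar {d : ℕ} (hd : 2 ≤ d) :
    MeasurePreserving (fun z : Metric.sphere (0 : Space d) 1 × ℝ ↦ z.2 • (z.1 : Space d))
      ((sphereMeasure d).prod (radialMeasure d)) volume := by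
  have h1 := (volume : Measure (Space d)).measurePreserving_homeomorphUnitSphereProd
  have h2 : MeasurePreserving (Subtype.val : Set.Ioi (0 : ℝ) → ℝ)
      (Measure.volumeIoiPow (d - 1)) (radialMeasure d) :=
    ⟨measurable_subtype_coe, map_volumeIoiPow _⟩
  have h3 := (MeasurePreserving.id (sphereMeasure d)).prod h2
  have h4 : MeasurePreserving (Subtype.val : ({0}ᶜ : Set (Space d)) → Space d)
      ((volume : Measure (Space d)).comap Subtype.val) (volume.restrict {0}ᶜ) :=
    ⟨measurable_subtype_coe, map_comap_subtype_coe (measurableSet_singleton _).compl _⟩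
  rw [finrank_euclideanSpace_fin] at h1
  have h5 := h3.comp h1
  have : Nontrivial (Space d) := by
    have : Nonempty (Fin d) := ⟨⟨0, by omega⟩⟩
    infer_instance
  rw [restrict_compl_singleton] at h4
  refine ⟨by fun_prop, ?_⟩
  rw [← h5.map_eq, Measure.map_map (by fun_prop) h5.measurable]
  refine Eq.trans ?_ h4.map_eq
  congr 1
  ext x : 1
  have hx : ‖(x : Space d)‖ ≠ 0 := norm_ne_zero_iff.2 x.2
  simp [Prod.map, smul_smul, hx]

lemma integrable_polar {d : ℕ} (hd : 2 ≤ d) {F : Space d → ℝ} (hF : Integrable F) :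
    Integrable (fun z : Metric.sphere (0 : Space d) 1 × ℝ ↦ F (z.2 • (z.1 : Space d)))
      ((sphereMeasure d).prod (radialMeasure d)) := by
  have h := measurePreserving_polar hd
  exact h.integrable_comp_of_integrable hF

instance (d : ℕ) : SFinite (radialMeasure d) := by
  unfold radialMeasure; infer_instance

lemma integral_polar {d : ℕ} (hd : 2 ≤ d) {F : Space d → ℝ} (hF : Integrable F) :
    ∫ x, F x = ∫ r, ∫ ω, F (r • (ω : Space d)) ∂(sphereMeasure d) ∂(radialMeasure d) := by
  have h := measurePreserving_polar hd
  rw [← integral_prod_symm _ (integrable_polar hd hF), ← h.map_eq,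
    integral_map h.measurable.aemeasurable (by rw [h.map_eq]; exact hF.1)]

lemma integral_radialMeasure (d : ℕ) (f : ℝ → ℝ) :
    ∫ r, f r ∂(radialMeasure d) = ∫ r in Set.Ioi 0, r ^ (d - 1) * f r := by
  unfold radialMeasure
  rw [integral_withDensity_eq_integral_toReal_smul (by fun_prop) (by simp)]
  refine setIntegral_congr_fun measurableSet_Ioi fun r hr ↦ ?_
  simp only [smul_eq_mul]
  rw [ENNReal.toReal_ofReal (pow_nonneg (le_of_lt hr) _)]

lemma ae_radialMeasure_pos (d : ℕ) : ∀ᵐ r ∂(radialMeasure d), 0 < r :=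
  (withDensity_absolutelyContinuous _ _).ae_le (ae_restrict_mem measurableSet_Ioi)

lemma ae_radialMeasure_ne (d : ℕ) (s : ℝ) : ∀ᵐ r ∂(radialMeasure d), r ≠ s :=
  (withDensity_absolutelyContinuous _ _).ae_le
    (ae_restrict_of_ae (by simp [ae_iff]))

/-! ### The radial profile of the Coulomb kernel. -/

/-- The constant in `w'(r) = -k / r ^ (d - 1)`. -/
def coulombSlope (d : ℕ) : ℝ := if d = 2 then 1 else (d : ℝ) - 2

lemma coulombSlope_pos {d : ℕ} (hd : 2 ≤ d) : 0 < coulombSlope d := by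
  unfold coulombSlope
  split_ifs with h
  · norm_num
  · have : (3 : ℝ) ≤ d := by exact_mod_cast (by omega : 3 ≤ d)
    linarith

lemma coulombConst_eq (d : ℕ) :
    coulombConst d = coulombSlope d * (sphereMeasure d).real Set.univ := by
  unfold coulombConst coulombSlope
  split_ifs with h
  · subst h
    rw [Measure.toSphere_real_apply_univ]
    simp [Measure.real, Real.pi_pos.le]
  · rfl

lemma hasDerivAt_coulombProfile {d : ℕ} (hd : 2 ≤ d) {r : ℝ} (hr : 0 < r) :
    HasDerivAt (coulombProfile d) (-coulombSlope d / r ^ (d - 1)) r := by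
  unfold coulombSlope
  split_ifs with h
  · subst h
    have : coulombProfile 2 = fun r ↦ -Real.log r := by ext r; simp [coulombProfile]
    rw [this]
    convert! (Real.hasDerivAt_log hr.ne').neg using 1
    simp [neg_div]
  · have : coulombProfile d = fun r ↦ (r ^ (d - 2))⁻¹ := by ext r; simp [coulombProfile, h]
    rw [this]
    convert! (hasDerivAt_pow (d - 2) r).inv (pow_ne_zero _ hr.ne') using 1
    obtain ⟨n, rfl⟩ : ∃ n, d = n + 3 := ⟨d - 3, by omega⟩
    simp only [show n + 3 - 1 = n + 2 by omega, show n + 3 - 2 = n + 1 by omega,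
      Nat.add_sub_cancel]
    push_cast
    field_simp
    ring

lemma coulombProfile_anti {d : ℕ} {r s : ℝ} (hr : 0 < r) (h : r ≤ s) :
    coulombProfile d s ≤ coulombProfile d r := by
  unfold coulombProfile
  split_ifs
  · exact neg_le_neg (Real.log_le_log hr h)
  · gcongr

/-- On `[s, ∞)` the slope is largest at `s`. Freezing the profile below `s` gives a Lipschitz
function, for which integration by parts is available despite the kink at `s`. -/
lemma lipschitzWith_truncated_profile {d : ℕ} (hd : 2 ≤ d) {s : ℝ} (hs : 0 < s) :
    LipschitzWith (Real.toNNReal (coulombSlope d / s ^ (d - 1)))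
      fun r ↦ coulombProfile d (max r s) := by
  have hk := coulombSlope_pos hd
  have h1 : LipschitzOnWith (Real.toNNReal (coulombSlope d / s ^ (d - 1))) (coulombProfile d)
      (Set.Ici s) := by
    refine Convex.lipschitzOnWith_of_nnnorm_hasDerivWithin_le (convex_Ici s)
      (fun r hr ↦ (hasDerivAt_coulombProfile hd (hs.trans_le hr)).hasDerivWithinAt) fun r hr ↦ ?_
    have hr' : s ≤ r := hr
    have hr0 : 0 < r := hs.trans_le hr'
    rw [← NNReal.coe_le_coe, coe_nnnorm, Real.coe_toNNReal _ (by positivity), neg_div, norm_neg,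
      Real.norm_of_nonneg (by positivity)]
    gcongr
  have h2 : LipschitzWith 1 fun r : ℝ ↦ max r s := LipschitzWith.id.max_const s
  have h3 := h1.comp (h2.lipschitzOnWith (s := Set.univ)) (fun r _ ↦ le_max_right r s)
  rw [mul_one] at h3
  exact lipschitzOnWith_univ.1 h3

lemma continuousOn_coulombProfile {d : ℕ} (hd : 2 ≤ d) :
    ContinuousOn (coulombProfile d) (Set.Ioi 0) := fun _ hr ↦
  (hasDerivAt_coulombProfile hd hr).continuousAt.continuousWithinAt

lemma measurable_coulombProfile (d : ℕ) : Measurable (coulombProfile d) := by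
  unfold coulombProfile
  split_ifs
  · exact Real.measurable_log.neg
  · fun_prop

lemma measurable_coulombKernel (d : ℕ) : Measurable (coulombKernel d) :=
  (measurable_coulombProfile d).comp measurable_norm

/-! ### Integrals of radial derivatives over balls. -/

lemma integral_polar' {d : ℕ} (hd : 2 ≤ d) {F : Space d → ℝ} (hF : Integrable F) :
    ∫ x, F x = ∫ ω, ∫ r, F (r • (ω : Space d)) ∂(radialMeasure d) ∂(sphereMeasure d) := by
  have h := measurePreserving_polar hd
  rw [← integral_prod _ (integrable_polar hd hF), ← h.map_eq,
    integral_map h.measurable.aemeasurable (by rw [h.map_eq]; exact hF.1)]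

lemma nontrivial_space {d : ℕ} (hd : 2 ≤ d) : Nontrivial (Space d) := by
  have : Nonempty (Fin d) := ⟨⟨0, by omega⟩⟩
  infer_instance

/-- The singularity is cancelled exactly by the Jacobian `r ^ (d - 1)`. This function dominates the
kernel, its gradient and the fields `∇f_η`. -/
lemma integrable_indicator_inv_norm_pow {d : ℕ} (hd : 2 ≤ d) (s : ℝ) :
    Integrable fun x : Space d ↦ (Metric.ball (0 : Space d) s).indicator
      (fun x ↦ (‖x‖ ^ (d - 1))⁻¹) x := by
  have := nontrivial_space hd
  rw [integrable_indicator_iff Metric.isOpen_ball.measurableSet,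
    integrableOn_fun_norm_addHaar volume (f := fun r ↦ (r ^ (d - 1))⁻¹), finrank_euclideanSpace_fin]
  refine (integrableOn_const (C := (1 : ℝ)) (by simp)).congr_fun (fun r hr ↦ ?_)
    measurableSet_Ioo
  simp [mul_inv_cancel₀ (pow_ne_zero (d - 1) hr.1.ne')]

lemma abs_fderiv_radial_le {d : ℕ} (hd : 2 ≤ d) (φ : Space d → ℝ) (x : Space d) :
    |(‖x‖ ^ d)⁻¹ * fderiv ℝ φ x x| ≤ ‖fderiv ℝ φ x‖ * (‖x‖ ^ (d - 1))⁻¹ := by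
  rcases eq_or_ne x 0 with rfl | hx
  · simp only [map_zero, mul_zero, abs_zero]; positivity
  have h0 : 0 < ‖x‖ := norm_pos_iff.2 hx
  have h1 : ‖x‖ ^ d = ‖x‖ ^ (d - 1) * ‖x‖ := by
    rw [← pow_succ, Nat.sub_add_cancel (by omega)]
  rw [abs_mul, abs_of_pos (by positivity), h1]
  calc _ ≤ (‖x‖ ^ (d - 1) * ‖x‖)⁻¹ * (‖fderiv ℝ φ x‖ * ‖x‖) := by
        gcongr; exact (fderiv ℝ φ x).le_opNorm x
    _ = _ := by field_simp

lemma integrableOn_radial_fderiv {d : ℕ} (hd : 2 ≤ d) {φ : Space d → ℝ} (hφ : ContDiff ℝ 1 φ)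
    (s : ℝ) :
    IntegrableOn (fun x ↦ (‖x‖ ^ d)⁻¹ * fderiv ℝ φ x x) (Metric.ball 0 s) := by
  have hc : Continuous (fderiv ℝ φ) := hφ.continuous_fderiv (by simp)
  obtain ⟨C, hC⟩ := (isCompact_closedBall (0 : Space d) s).exists_bound_of_continuousOn
    hc.continuousOn
  have h := (integrable_indicator_inv_norm_pow hd s).const_mul C
  rw [← integrable_indicator_iff Metric.isOpen_ball.measurableSet]
  refine h.mono' ?_ (ae_of_all _ fun x ↦ ?_)
  · refine AEStronglyMeasurable.indicator ?_ Metric.isOpen_ball.measurableSet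
    refine Measurable.aestronglyMeasurable ?_
    exact ((measurable_norm.pow_const d).inv).mul
      (hc.clm_apply continuous_id).measurable
  · by_cases hx : x ∈ Metric.ball (0 : Space d) s
    · rw [Set.indicator_of_mem hx, Set.indicator_of_mem hx, Real.norm_eq_abs]
      refine (abs_fderiv_radial_le hd φ x).trans ?_
      gcongr
      exact hC x (Metric.ball_subset_closedBall hx)
    · simp [Set.indicator_of_notMem hx]

/-- In polar coordinates the integrand times the Jacobian is the derivative of `φ` along the ray, so
the fundamental theorem of calculus applies on each ray. -/
lemma setIntegral_ball_radial_fderiv {d : ℕ} (hd : 2 ≤ d) {φ : Space d → ℝ}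
    (hφ : ContDiff ℝ 1 φ) {s : ℝ} (hs : 0 < s) :
    ∫ x in Metric.ball 0 s, (‖x‖ ^ d)⁻¹ * fderiv ℝ φ x x =
      ∫ ω, (φ (s • (ω : Space d)) - φ 0) ∂(sphereMeasure d) := by
  have hc : Continuous (fderiv ℝ φ) := hφ.continuous_fderiv (by simp)
  rw [← integral_indicator Metric.isOpen_ball.measurableSet, integral_polar' hd
    ((integrable_indicator_iff Metric.isOpen_ball.measurableSet).2
      (integrableOn_radial_fderiv hd hφ s))]
  congr 1
  ext ω
  have hω : ‖(ω : Space d)‖ = 1 := by simp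
  rw [integral_radialMeasure]
  have h1 : ∫ r in (0 : ℝ)..s, fderiv ℝ φ (r • (ω : Space d)) ω = φ (s • (ω : Space d)) - φ 0 := by
    have := intervalIntegral.integral_eq_sub_of_hasDerivAt (a := 0) (b := s)
      (f := fun r : ℝ ↦ φ (r • (ω : Space d))) (f' := fun r ↦ fderiv ℝ φ (r • (ω : Space d)) ω)
      (fun r _ ↦ ?_) ?_
    · simpa using this
    · have h2 : HasDerivAt (fun r : ℝ ↦ r • (ω : Space d)) ((1 : ℝ) • (ω : Space d)) r :=
        (hasDerivAt_id r).smul_const _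
      rw [one_smul] at h2
      exact ((hφ.differentiable (by simp) _).hasFDerivAt).comp_hasDerivAt r h2
    · refine Continuous.intervalIntegrable ?_ _ _
      exact (hc.comp (by fun_prop)).clm_apply continuous_const
  rw [← h1, intervalIntegral.integral_of_le hs.le, ← integral_Ioc_eq_integral_Ioo.symm,
    ← Set.Ioi_inter_Iio, ← setIntegral_indicator measurableSet_Iio]
  refine setIntegral_congr_fun measurableSet_Ioi fun r hr ↦ ?_
  have hr0 : (0 : ℝ) < r := hr
  have hn : ‖r • (ω : Space d)‖ = r := by rw [norm_smul, hω, mul_one, Real.norm_of_nonneg hr0.le]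
  by_cases hrs : r < s
  · rw [Set.indicator_of_mem (by simpa [hn] using hrs), Set.indicator_of_mem (Set.mem_Iio.2 hrs)]
    simp only [hn, map_smul, smul_eq_mul]
    have h3 : r ^ d = r ^ (d - 1) * r := by rw [← pow_succ, Nat.sub_add_cancel (by omega)]
    rw [h3]
    field_simp
  · rw [Set.indicator_of_notMem (by simpa [hn] using hrs), Set.indicator_of_notMem (fun h ↦ hrs (Set.mem_Iio.1 h)), mul_zero]

/-! ### Test functions and the Laplacian in coordinates. -/

/-- The `i`-th standard basis vector. -/
abbrev stdVec {d : ℕ} (i : Fin d) : Space d := EuclideanSpace.basisFun (Fin d) ℝ i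

lemma laplacian_eq_sum {d : ℕ} {φ : Space d → ℝ} (hφ : ContDiff ℝ 2 φ) (x : Space d) :
    Laplacian.laplacian φ x =
      ∑ i, fderiv ℝ (fun y ↦ fderiv ℝ φ y (stdVec i)) x (stdVec i) := by
  rw [InnerProductSpace.laplacian_eq_iteratedFDeriv_orthonormalBasis φ
    (EuclideanSpace.basisFun (Fin d) ℝ)]
  refine Finset.sum_congr rfl fun i _ ↦ ?_
  have h : DifferentiableAt ℝ (fderiv ℝ φ) x :=
    (hφ.fderiv_right (m := 1) (by norm_num)).differentiable (by simp) x
  rw [iteratedFDeriv_two_apply, fderiv_clm_apply h (by fun_prop)]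
  simp

lemma fderiv_apply_eq_sum {d : ℕ} (φ : Space d → ℝ) (x v : Space d) :
    fderiv ℝ φ x v = ∑ i, v i * fderiv ℝ φ x (stdVec i) := by
  conv_lhs => rw [← (EuclideanSpace.basisFun (Fin d) ℝ).sum_repr v]
  simp [map_sum]

lemma IsTestFunction.fderiv_apply {d : ℕ} {φ : Space d → ℝ} (hφ : IsTestFunction φ)
    (v : Space d) : IsTestFunction fun x ↦ fderiv ℝ φ x v :=
  ⟨(hφ.1.fderiv_right (m := ((⊤ : ℕ∞) : WithTop ℕ∞)) (by norm_cast)).clm_apply contDiff_const,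
    hφ.2.fderiv_apply ℝ v⟩

lemma IsTestFunction.contDiff_nat {d : ℕ} {φ : Space d → ℝ} (hφ : IsTestFunction φ)
    (n : ℕ) : ContDiff ℝ n φ := hφ.1.of_le (by exact_mod_cast le_top)

lemma IsTestFunction.continuous {d : ℕ} {φ : Space d → ℝ} (hφ : IsTestFunction φ) :
    Continuous φ := hφ.1.continuous

lemma IsTestFunction.laplacian_eq {d : ℕ} {φ : Space d → ℝ} (hφ : IsTestFunction φ) :
    Laplacian.laplacian φ = fun x ↦
      ∑ i, fderiv ℝ (fun y ↦ fderiv ℝ φ y (stdVec i)) x (stdVec i) :=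
  funext fun x ↦ laplacian_eq_sum (hφ.contDiff_nat 2) x

lemma hasCompactSupport_finset_sum {X ι : Type*} [TopologicalSpace X] (s : Finset ι)
    {f : ι → X → ℝ} (h : ∀ i ∈ s, HasCompactSupport (f i)) :
    HasCompactSupport fun x ↦ ∑ i ∈ s, f i x := by
  classical
  induction s using Finset.induction_on with
  | empty =>
    simp only [Finset.sum_empty]
    exact HasCompactSupport.zero
  | insert a s ha ih =>
    simp only [Finset.sum_insert ha]
    exact (h a (by simp)).add (ih fun i hi ↦ h i (by simp [hi]))

lemma IsTestFunction.finset_sum {d : ℕ} {ι : Type*} (s : Finset ι) {f : ι → Space d → ℝ}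
    (h : ∀ i ∈ s, IsTestFunction (f i)) : IsTestFunction fun x ↦ ∑ i ∈ s, f i x :=
  ⟨ContDiff.sum fun i hi ↦ (h i hi).1, hasCompactSupport_finset_sum s fun i hi ↦ (h i hi).2⟩

lemma IsTestFunction.laplacian {d : ℕ} {φ : Space d → ℝ} (hφ : IsTestFunction φ) :
    IsTestFunction (Laplacian.laplacian φ) := by
  rw [hφ.laplacian_eq]
  exact IsTestFunction.finset_sum _ fun i _ ↦ (hφ.fderiv_apply _).fderiv_apply _

lemma IsTestFunction.exists_lipschitz {d : ℕ} {φ : Space d → ℝ} (hφ : IsTestFunction φ) :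
    ∃ C, LipschitzWith C φ :=
  ContDiff.lipschitzWith_of_hasCompactSupport hφ.2 hφ.1 (by simp)

/-! ### The Laplacian of the potential of a sphere. -/

/-- The potential, up to a constant factor, of the uniform measure on the sphere of radius `s`. -/
def spherePotential (d : ℕ) (s : ℝ) (x : Space d) : ℝ := coulombProfile d (max ‖x‖ s)

lemma exists_lipschitzWith_spherePotential {d : ℕ} (hd : 2 ≤ d) {s : ℝ} (hs : 0 < s) :
    ∃ C, LipschitzWith C (spherePotential d s) :=
  ⟨_, (lipschitzWith_truncated_profile hd hs).comp (lipschitzWith_one_norm)⟩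

lemma hasFDerivAt_norm_of_ne {d : ℕ} {x : Space d} (hx : x ≠ 0) :
    HasFDerivAt (fun y : Space d ↦ ‖y‖) ((‖x‖⁻¹) • innerSL ℝ x) x := by
  have h := (HasStrictFDerivAt.hasFDerivAt (hasStrictFDerivAt_norm_sq x)).sqrt
    (pow_ne_zero 2 (norm_ne_zero_iff.2 hx))
  have hn : 0 < ‖x‖ := norm_pos_iff.2 hx
  simp only [Real.sqrt_sq (norm_nonneg _)] at h
  convert! h using 1
  ext v
  simp
  field_simp

lemma hasFDerivAt_profile_norm {d : ℕ} {ψ : ℝ → ℝ} {c : ℝ} {x : Space d} (hx : x ≠ 0)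
    (h : HasDerivAt ψ c ‖x‖) :
    HasFDerivAt (fun y : Space d ↦ ψ ‖y‖) ((c * ‖x‖⁻¹) • innerSL ℝ x) x := by
  have := h.comp_hasFDerivAt x (hasFDerivAt_norm_of_ne hx)
  rwa [smul_smul] at this

lemma lineDeriv_spherePotential_of_lt {d : ℕ} {s : ℝ} {x : Space d} (hx : ‖x‖ < s)
    (v : Space d) : lineDeriv ℝ (spherePotential d s) x v = 0 := by
  have h : spherePotential d s =ᶠ[nhds x] fun _ ↦ coulombProfile d s := by
    filter_upwards [(isOpen_lt continuous_norm continuous_const).mem_nhds hx] with y hy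
    simp only [spherePotential]
    rw [max_eq_right (le_of_lt hy)]
  rw [h.lineDeriv_eq]
  simp [lineDeriv]

lemma lineDeriv_spherePotential_of_gt {d : ℕ} (hd : 2 ≤ d) {s : ℝ} (hs : 0 < s) {x : Space d}
    (hx : s < ‖x‖) (v : Space d) :
    lineDeriv ℝ (spherePotential d s) x v = -coulombSlope d * ((‖x‖ ^ d)⁻¹ * inner ℝ x v) := by
  have h : spherePotential d s =ᶠ[nhds x] fun y ↦ coulombProfile d ‖y‖ := by
    filter_upwards [(isOpen_lt continuous_const continuous_norm).mem_nhds hx] with y hy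
    simp only [spherePotential]
    rw [max_eq_left (le_of_lt hy)]
  have hn : 0 < ‖x‖ := hs.trans hx
  rw [h.lineDeriv_eq, (hasFDerivAt_profile_norm (norm_pos_iff.1 hn)
    (hasDerivAt_coulombProfile hd hn)).hasLineDerivAt v |>.lineDeriv]
  have h3 : ‖x‖ ^ d = ‖x‖ ^ (d - 1) * ‖x‖ := by rw [← pow_succ, Nat.sub_add_cancel (by omega)]
  simp
  rw [h3]
  field_simp

lemma ae_norm_ne {d : ℕ} (hd : 2 ≤ d) (s : ℝ) : ∀ᵐ x : Space d, ‖x‖ ≠ s := by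
  have := nontrivial_space hd
  have h := Measure.addHaar_sphere (volume : Measure (Space d)) 0 s
  filter_upwards [compl_mem_ae_iff.2 h] with x hx
  simpa using hx

lemma exists_ball_of_hasCompactSupport {d : ℕ} {φ : Space d → ℝ} (hφ : HasCompactSupport φ)
    (s : ℝ) : ∃ S, s < S ∧ 0 < S ∧ tsupport φ ⊆ Metric.ball 0 S := by
  obtain ⟨r, hr⟩ := hφ.isBounded.subset_ball (0 : Space d)
  refine ⟨max r (max (s + 1) 1), ?_, ?_, hr.trans (Metric.ball_subset_ball (le_max_left _ _))⟩
  · exact lt_of_lt_of_le (lt_add_one s) ((le_max_left _ _).trans (le_max_right _ _))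
  · exact lt_of_lt_of_le one_pos ((le_max_right _ _).trans (le_max_right _ _))

/-- One integration by parts, legitimate because the potential is Lipschitz, leaves its gradient:
zero inside the sphere and `-k x / |x| ^ d` outside. The remaining radial integral is explicit. -/
lemma integral_spherePotential_mul_laplacian {d : ℕ} (hd : 2 ≤ d) {φ : Space d → ℝ}
    (hφ : IsTestFunction φ) {s : ℝ} (hs : 0 < s) :
    ∫ x, spherePotential d s x * Laplacian.laplacian φ x =
      -coulombSlope d * ∫ ω, φ (s • (ω : Space d)) ∂(sphereMeasure d) := by
  obtain ⟨C, hC⟩ := exists_lipschitzWith_spherePotential hd hs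
  have hpart : ∀ i : Fin d, ∫ x, spherePotential d s x *
      fderiv ℝ (fun y ↦ fderiv ℝ φ y (stdVec i)) x (stdVec i) =
      -∫ x, lineDeriv ℝ (spherePotential d s) x (stdVec i) * fderiv ℝ φ x (stdVec i) := by
    intro i
    have hg := hφ.fderiv_apply (stdVec i)
    obtain ⟨D, hD⟩ := hg.exists_lipschitz
    rw [hC.integral_lineDeriv_mul_eq hD hg.2, ← integral_neg]
    congr 1
    ext x
    rw [((hg.1.differentiable (by simp)) x).lineDeriv_eq_fderiv]
    simp [mul_comm]
  have hint1 : ∀ i : Fin d, Integrable fun x ↦ spherePotential d s x *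
      fderiv ℝ (fun y ↦ fderiv ℝ φ y (stdVec i)) x (stdVec i) := fun i ↦
    (hC.continuous.mul ((hφ.fderiv_apply _).fderiv_apply _).continuous).integrable_of_hasCompactSupport
      ((hφ.fderiv_apply _).fderiv_apply _).2.mul_left
  have hint2 : ∀ i : Fin d, Integrable fun x ↦
      lineDeriv ℝ (spherePotential d s) x (stdVec i) * fderiv ℝ φ x (stdVec i) := fun i ↦
    ((hφ.fderiv_apply _).continuous.integrable_of_hasCompactSupport
      (hφ.fderiv_apply _).2).smul_of_top_right (hC.memLp_lineDeriv _)
  obtain ⟨S, hsS, hS, hsupp⟩ := exists_ball_of_hasCompactSupport hφ.2 s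
  have hφ1 := hφ.contDiff_nat 1
  have hball : Metric.ball (0 : Space d) s ⊆ Metric.ball 0 S := Metric.ball_subset_ball hsS.le
  have hzero : ∀ x : Space d, S ≤ ‖x‖ → fderiv ℝ φ x = 0 := fun x hx ↦ by
    have : x ∉ tsupport φ := fun h ↦ by simpa using (hsupp h).trans_le hx
    exact image_eq_zero_of_notMem_tsupport (fun h ↦ this (tsupport_fderiv_subset ℝ h))
  -- The potential is constant inside radius `s` and `φ` vanishes beyond `S`, so only the annulus
  -- between them contributes.
  have hkey : ∫ x, ∑ i, lineDeriv ℝ (spherePotential d s) x (stdVec i) *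
        fderiv ℝ φ x (stdVec i) =
      -coulombSlope d * ∫ x in Metric.ball 0 S \ Metric.ball 0 s,
        (‖x‖ ^ d)⁻¹ * fderiv ℝ φ x x := by
    rw [← integral_const_mul, ← integral_indicator
      (Metric.isOpen_ball.measurableSet.diff Metric.isOpen_ball.measurableSet)]
    refine integral_congr_ae ?_
    filter_upwards [ae_norm_ne hd s] with x hx
    rcases lt_or_gt_of_ne hx with h | h
    · rw [Set.indicator_of_notMem (by simp [h])]
      simp [lineDeriv_spherePotential_of_lt h]
    · simp only [lineDeriv_spherePotential_of_gt hd hs h]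
      have : ∑ i, -coulombSlope d * ((‖x‖ ^ d)⁻¹ * inner ℝ x (stdVec i)) * fderiv ℝ φ x (stdVec i)
          = -coulombSlope d * ((‖x‖ ^ d)⁻¹ * fderiv ℝ φ x x) := by
        rw [fderiv_apply_eq_sum φ x x, Finset.mul_sum, Finset.mul_sum]
        refine Finset.sum_congr rfl fun i _ ↦ ?_
        have : inner ℝ x (stdVec i) = x i := by simp [EuclideanSpace.inner_single_right]
        rw [this]
        ring
      rw [this]
      by_cases hxS : ‖x‖ < S
      · rw [Set.indicator_of_mem (by simp [hxS, h.le])]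
      · rw [Set.indicator_of_notMem (by simp [hxS]), hzero x (not_lt.1 hxS)]
        simp
  have hcφ : ∀ t : ℝ, Integrable (fun ω : Metric.sphere (0 : Space d) 1 ↦ φ (t • (ω : Space d)))
      (sphereMeasure d) := fun t ↦
    (hφ.continuous.comp (by fun_prop)).integrable_of_hasCompactSupport
      (HasCompactSupport.of_compactSpace _)
  rw [hφ.laplacian_eq]
  simp only [Finset.mul_sum]
  rw [integral_finsetSum _ fun i _ ↦ hint1 i, Finset.sum_congr rfl fun i _ ↦ hpart i,
    Finset.sum_neg_distrib, ← integral_finsetSum _ fun i _ ↦ hint2 i, hkey,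
    setIntegral_sdiff Metric.isOpen_ball.measurableSet (integrableOn_radial_fderiv hd hφ1 S) hball,
    setIntegral_ball_radial_fderiv hd hφ1 hs, setIntegral_ball_radial_fderiv hd hφ1 hS,
    integral_sub (hcφ _) (integrable_const _), integral_sub (hcφ _) (integrable_const _)]
  have : ∀ ω : Metric.sphere (0 : Space d) 1, φ (S • (ω : Space d)) = 0 := fun ω ↦ by
    refine image_eq_zero_of_notMem_tsupport fun h ↦ ?_
    have := hsupp h
    simp [norm_smul, abs_of_pos hS] at this
  simp [this]
  ring

/-! ### Local integrability of `w` and its distributional Laplacian. -/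

lemma exists_profile_bound {d : ℕ} (hd : 2 ≤ d) (s : ℝ) :
    ∃ C, ∀ r, 0 ≤ r → r ≤ s → |coulombProfile d r| ≤ C * (r ^ (d - 1))⁻¹ := by
  refine ⟨1 + s ^ 2 + s, fun r hr0 hrs ↦ ?_⟩
  rcases hr0.eq_or_lt with rfl | hr
  -- The default values `log 0 = 0` and `1 / 0 = 0` make the bound hold at the origin too.
  · have : coulombProfile d 0 = 0 := by
      unfold coulombProfile
      split_ifs with h
      · simp
      · simp [zero_pow (show d - 2 ≠ 0 by omega)]
    rw [this, abs_zero]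
    positivity
  have hs : 0 < s := hr.trans_le hrs
  rw [← div_eq_mul_inv, le_div_iff₀ (by positivity)]
  unfold coulombProfile
  split_ifs with h
  · subst h
    simp only [abs_neg, Nat.add_one_sub_one, pow_one]
    rcases le_total r 1 with h1 | h1
    · have := Real.abs_log_mul_self_lt r hr h1
      rw [abs_mul, abs_of_pos hr] at this
      nlinarith
    · rw [abs_of_nonneg (Real.log_nonneg h1)]
      have h2 := Real.log_le_self hr.le
      nlinarith
  · have h3 : r ^ (d - 1) = r ^ (d - 2) * r := by rw [← pow_succ]; congr 1; omega
    rw [abs_of_pos (by positivity), h3]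
    field_simp
    nlinarith

lemma integrableOn_coulombKernel {d : ℕ} (hd : 2 ≤ d) (s : ℝ) :
    IntegrableOn (coulombKernel d) (Metric.ball 0 s) := by
  obtain ⟨C, hC⟩ := exists_profile_bound hd s
  rw [← integrable_indicator_iff Metric.isOpen_ball.measurableSet]
  refine ((integrable_indicator_inv_norm_pow hd s).const_mul C).mono'
    ((measurable_coulombKernel d).aestronglyMeasurable.indicator
      Metric.isOpen_ball.measurableSet) (ae_of_all _ fun x ↦ ?_)
  by_cases hx : x ∈ Metric.ball (0 : Space d) s
  · rw [Set.indicator_of_mem hx, Set.indicator_of_mem hx]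
    exact hC _ (norm_nonneg _) (by simpa using (Metric.ball_subset_closedBall hx))
  · simp [Set.indicator_of_notMem hx]

lemma locallyIntegrable_coulombKernel {d : ℕ} (hd : 2 ≤ d) :
    LocallyIntegrable (coulombKernel d) := by
  rw [locallyIntegrable_iff]
  intro K hK
  obtain ⟨r, hr⟩ := hK.isBounded.subset_ball (0 : Space d)
  exact (integrableOn_coulombKernel hd r).mono_set hr

/-- The profile frozen at `s` lies between the one frozen at `t` and the true one. This gives a
domination uniform in `s ≤ t` for the limit `s → 0`. -/
lemma abs_profile_max_le {d : ℕ} {r s t : ℝ} (hr : 0 < r) (hst : s ≤ t) :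
    |coulombProfile d (max r s)| ≤ |coulombProfile d r| + |coulombProfile d (max r t)| := by
  have h1 : coulombProfile d (max r s) ≤ coulombProfile d r :=
    coulombProfile_anti hr (le_max_left _ _)
  have h2 : coulombProfile d (max r t) ≤ coulombProfile d (max r s) :=
    coulombProfile_anti (lt_max_of_lt_left hr) (max_le_max_left _ hst)
  have h3 := le_abs_self (coulombProfile d r)
  have h4 := neg_abs_le (coulombProfile d (max r t))
  rw [abs_le]
  constructor <;> linarith [abs_nonneg (coulombProfile d r), abs_nonneg (coulombProfile d (max r t))]

lemma ae_ne_zero {d : ℕ} (hd : 2 ≤ d) : ∀ᵐ x : Space d, x ≠ 0 := by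
  filter_upwards [ae_norm_ne hd 0] with x hx
  simpa using hx

lemma IsTestFunction.integrable_mul {d : ℕ} {φ : Space d → ℝ} (hφ : IsTestFunction φ)
    {f : Space d → ℝ} (hf : LocallyIntegrable f) : Integrable fun x ↦ f x * φ x := by
  simpa [mul_comm] using hf.integrable_smul_left_of_hasCompactSupport hφ.continuous hφ.2

lemma continuous_sphere_average {d : ℕ} {φ : Space d → ℝ} (hφ : IsTestFunction φ) :
    Continuous fun s : ℝ ↦ ∫ ω, φ (s • (ω : Space d)) ∂(sphereMeasure d) := by
  obtain ⟨C, hC⟩ := hφ.2.exists_bound_of_continuous hφ.continuous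
  refine continuous_of_dominated (bound := fun _ ↦ C) (fun s ↦ ?_) (fun s ↦ ae_of_all _ fun ω ↦ hC _)
    (integrable_const _) (ae_of_all _ fun ω ↦ hφ.continuous.comp (by fun_prop))
  exact (hφ.continuous.comp (by fun_prop)).aestronglyMeasurable

/-- `-Δ w = c_d δ₀`. -/
lemma integral_coulombKernel_mul_laplacian_zero {d : ℕ} (hd : 2 ≤ d) {φ : Space d → ℝ}
    (hφ : IsTestFunction φ) :
    ∫ x, coulombKernel d x * Laplacian.laplacian φ x = -coulombConst d * φ 0 := by
  obtain ⟨C, hC⟩ := exists_lipschitzWith_spherePotential hd one_pos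
  have hΔ := hφ.laplacian
  -- The point charge is the limit of charged spheres whose radii shrink to zero; away from the
  -- origin the potentials are eventually equal to `w`.
  have hlim : Tendsto (fun n : ℕ ↦ ∫ x, spherePotential d (1 / ((n : ℝ) + 1)) x *
      Laplacian.laplacian φ x) atTop (nhds (∫ x, coulombKernel d x * Laplacian.laplacian φ x)) := by
    refine tendsto_integral_of_dominated_convergence (fun x ↦ |coulombKernel d x *
      Laplacian.laplacian φ x| + |spherePotential d 1 x * Laplacian.laplacian φ x|)
      (fun n ↦ ?_) ?_ (fun n ↦ ?_) ?_
    · obtain ⟨D, hD⟩ := exists_lipschitzWith_spherePotential hd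
        (show (0 : ℝ) < 1 / ((n : ℝ) + 1) by positivity)
      exact (hD.continuous.mul hΔ.continuous).aestronglyMeasurable
    · exact (hΔ.integrable_mul (locallyIntegrable_coulombKernel hd)).abs.add
        (hΔ.integrable_mul hC.continuous.locallyIntegrable).abs
    · filter_upwards [ae_ne_zero hd] with x hx
      rw [Real.norm_eq_abs, abs_mul, abs_mul, abs_mul, ← add_mul]
      gcongr
      refine abs_profile_max_le (norm_pos_iff.2 hx) ?_
      rw [div_le_one (by positivity)]
      linarith [(Nat.cast_nonneg n : (0 : ℝ) ≤ n)]
    · filter_upwards [ae_ne_zero hd] with x hx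
      refine Tendsto.mul_const _ (tendsto_const_nhds.congr' ?_)
      have := (tendsto_one_div_add_atTop_nhds_zero_nat (𝕜 := ℝ)).eventually_le_const
        (norm_pos_iff.2 hx)
      filter_upwards [this] with n hn
      simp only [spherePotential, coulombKernel]
      rw [max_eq_left hn]
  have hlim2 : Tendsto (fun n : ℕ ↦ -coulombSlope d * ∫ ω, φ ((1 / ((n : ℝ) + 1)) • (ω : Space d))
      ∂(sphereMeasure d)) atTop (nhds (-coulombConst d * φ 0)) := by
    have h := ((continuous_sphere_average hφ).tendsto 0).comp
      (tendsto_one_div_add_atTop_nhds_zero_nat (𝕜 := ℝ))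
    have := h.const_mul (-coulombSlope d)
    simp only [zero_smul, integral_const] at this
    rw [coulombConst_eq]
    convert! this using 2
    simp only [smul_eq_mul]
    ring
  refine tendsto_nhds_unique hlim (hlim2.congr fun n ↦ ?_)
  rw [integral_spherePotential_mul_laplacian hd hφ (by positivity)]

lemma IsTestFunction.comp_add_right {d : ℕ} {φ : Space d → ℝ} (hφ : IsTestFunction φ)
    (y : Space d) : IsTestFunction fun x ↦ φ (x + y) :=
  ⟨hφ.1.comp (contDiff_id.add contDiff_const), hφ.2.comp_homeomorph (Homeomorph.addRight y)⟩

lemma IsTestFunction.comp_sub_right {d : ℕ} {φ : Space d → ℝ} (hφ : IsTestFunction φ)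
    (y : Space d) : IsTestFunction fun x ↦ φ (x - y) := by
  simpa [sub_eq_add_neg] using hφ.comp_add_right (-y)

lemma laplacian_comp_add_right {d : ℕ} {φ : Space d → ℝ} (hφ : IsTestFunction φ) (y x : Space d) :
    Laplacian.laplacian (fun x ↦ φ (x + y)) x = Laplacian.laplacian φ (x + y) := by
  rw [hφ.laplacian_eq, (hφ.comp_add_right y).laplacian_eq]
  simp only [fderiv_comp_add_right]
  refine Finset.sum_congr rfl fun i _ ↦ ?_
  rw [fderiv_comp_add_right (f := fun z ↦ fderiv ℝ φ z (stdVec i)) y]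

lemma integral_coulombKernel_mul_laplacian {d : ℕ} (hd : 2 ≤ d) {φ : Space d → ℝ}
    (hφ : IsTestFunction φ) (y : Space d) :
    ∫ x, coulombKernel d (x - y) * Laplacian.laplacian φ x = -coulombConst d * φ y := by
  have h := integral_coulombKernel_mul_laplacian_zero hd (hφ.comp_add_right y)
  simp only [laplacian_comp_add_right hφ, zero_add] at h
  rw [← h, ← integral_sub_right_eq_self
    (fun x ↦ coulombKernel d x * Laplacian.laplacian φ (x + y)) y]
  simp

/-! ### The mean value property and Newton's theorem for spheres. -/

/-- The mean value property. -/
lemma sphere_average_eq_of_laplacian_eq_zero {d : ℕ} (hd : 2 ≤ d) {φ : Space d → ℝ}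
    (hφ : IsTestFunction φ) {s : ℝ} (hs : 0 < s)
    (h : ∀ x, ‖x‖ < s → Laplacian.laplacian φ x = 0) :
    ∫ ω, φ (s • (ω : Space d)) ∂(sphereMeasure d) = (sphereMeasure d).real Set.univ * φ 0 := by
  have h1 := integral_spherePotential_mul_laplacian hd hφ hs
  have h2 := integral_coulombKernel_mul_laplacian_zero hd hφ
  -- The potentials of the point and of the sphere differ only inside the ball, where `Δφ = 0`.
  have h3 : ∫ x, coulombKernel d x * Laplacian.laplacian φ x =
      ∫ x, spherePotential d s x * Laplacian.laplacian φ x := by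
    congr 1
    ext x
    rcases lt_or_ge ‖x‖ s with hx | hx
    · rw [h x hx, mul_zero, mul_zero]
    · rw [spherePotential, max_eq_left hx, coulombKernel]
  rw [h3, h1, coulombConst_eq] at h2
  have hk := coulombSlope_pos hd
  have : coulombSlope d * (∫ ω, φ (s • (ω : Space d)) ∂(sphereMeasure d)) =
      coulombSlope d * ((sphereMeasure d).real Set.univ * φ 0) := by linarith
  exact mul_left_cancel₀ hk.ne' this

lemma contDiffAt_coulombKernel {d : ℕ} {x : Space d} (hx : x ≠ 0) {n : WithTop ℕ∞} :
    ContDiffAt ℝ n (coulombKernel d) x := by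
  have h := contDiffAt_norm ℝ hx (n := n)
  have hn := norm_ne_zero_iff.2 hx
  by_cases hd : d = 2
  · have : coulombKernel d = fun x ↦ -Real.log ‖x‖ := by
      ext; simp [coulombKernel, coulombProfile, hd]
    rw [this]
    exact (h.log hn).neg
  · have : coulombKernel d = fun x ↦ (‖x‖ ^ (d - 2))⁻¹ := by
      ext; simp [coulombKernel, coulombProfile, hd]
    rw [this]
    exact (h.pow _).inv (pow_ne_zero _ hn)

lemma hasFDerivAt_coulombKernel {d : ℕ} (hd : 2 ≤ d) {x : Space d} (hx : x ≠ 0) :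
    HasFDerivAt (coulombKernel d) ((-coulombSlope d * (‖x‖ ^ d)⁻¹) • innerSL ℝ x) x := by
  have hn := norm_pos_iff.2 hx
  convert! hasFDerivAt_profile_norm hx (hasDerivAt_coulombProfile hd hn) using 2
  have h3 : ‖x‖ ^ d = ‖x‖ ^ (d - 1) * ‖x‖ := by rw [← pow_succ, Nat.sub_add_cancel (by omega)]
  rw [h3]
  field_simp

lemma laplacian_eq_sum_of_contDiffAt {d : ℕ} {φ : Space d → ℝ} {x : Space d}
    (hφ : ContDiffAt ℝ 2 φ x) :
    Laplacian.laplacian φ x =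
      ∑ i, fderiv ℝ (fun y ↦ fderiv ℝ φ y (stdVec i)) x (stdVec i) := by
  rw [InnerProductSpace.laplacian_eq_iteratedFDeriv_orthonormalBasis φ
    (EuclideanSpace.basisFun (Fin d) ℝ)]
  refine Finset.sum_congr rfl fun i _ ↦ ?_
  have h : DifferentiableAt ℝ (fderiv ℝ φ) x :=
    (hφ.fderiv_right (m := 1) (by norm_num)).differentiableAt (by simp)
  rw [iteratedFDeriv_two_apply, fderiv_clm_apply h (by fun_prop)]
  simp

lemma laplacian_coulombKernel {d : ℕ} (hd : 2 ≤ d) {x : Space d} (hx : x ≠ 0) :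
    Laplacian.laplacian (coulombKernel d) x = 0 := by
  rw [laplacian_eq_sum_of_contDiffAt (contDiffAt_coulombKernel hx)]
  have hn := norm_pos_iff.2 hx
  have h1 : ∀ i : Fin d, (fun y ↦ fderiv ℝ (coulombKernel d) y (stdVec i)) =ᶠ[nhds x]
      fun y ↦ (-coulombSlope d * (‖y‖ ^ d)⁻¹) * y i := fun i ↦ by
    filter_upwards [isOpen_ne.mem_nhds hx] with y hy
    rw [(hasFDerivAt_coulombKernel hd hy).fderiv]
    simp [EuclideanSpace.inner_single_right]
  have h2 : HasFDerivAt (fun y : Space d ↦ -coulombSlope d * (‖y‖ ^ d)⁻¹)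
      (((coulombSlope d * (d * ‖x‖ ^ (d - 1) / (‖x‖ ^ d) ^ 2)) * ‖x‖⁻¹) • innerSL ℝ x) x := by
    refine hasFDerivAt_profile_norm (ψ := fun r ↦ -coulombSlope d * (r ^ d)⁻¹) hx ?_
    convert! ((hasDerivAt_pow d ‖x‖).inv (pow_ne_zero _ hn.ne')).const_mul (-coulombSlope d)
      using 1
    ring
  have h3 : ∀ i : Fin d, fderiv ℝ (fun y ↦ fderiv ℝ (coulombKernel d) y (stdVec i)) x (stdVec i) =
      coulombSlope d * (d * ‖x‖ ^ (d - 1) / (‖x‖ ^ d) ^ 2) * ‖x‖⁻¹ * x i ^ 2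
        - coulombSlope d * (‖x‖ ^ d)⁻¹ := fun i ↦ by
    rw [(h1 i).fderiv_eq]
    have h4 : HasFDerivAt (fun y : Space d ↦ y i)
        (EuclideanSpace.proj i : Space d →L[ℝ] ℝ) x :=
      (EuclideanSpace.proj i : Space d →L[ℝ] ℝ).hasFDerivAt
    rw [(show HasFDerivAt (fun y : Space d ↦ (-coulombSlope d * (‖y‖ ^ d)⁻¹) * y i) _ x from
      h2.mul h4).fderiv]
    simp [EuclideanSpace.inner_single_right]
    ring
  simp only [h3]
  rw [Finset.sum_sub_distrib, ← Finset.mul_sum, ← EuclideanSpace.real_norm_sq_eq]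
  simp only [Finset.sum_const, Finset.card_univ, Fintype.card_fin, nsmul_eq_mul]
  have h5 : ‖x‖ ^ d = ‖x‖ ^ (d - 1) * ‖x‖ := by rw [← pow_succ, Nat.sub_add_cancel (by omega)]
  rw [h5]
  field_simp
  ring

lemma laplacian_coulombKernel_sub {d : ℕ} (hd : 2 ≤ d) {x y : Space d} (hxy : y ≠ x) :
    Laplacian.laplacian (fun y ↦ coulombKernel d (x - y)) y = 0 := by
  have hne : y - x ≠ 0 := sub_ne_zero.2 hxy
  have h0 : (fun y ↦ coulombKernel d (x - y)) = fun y ↦ coulombKernel d (y - x) := by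
    ext y; simp [coulombKernel, norm_sub_rev]
  have h1 : ContDiffAt ℝ 2 (fun y ↦ coulombKernel d (y - x)) y :=
    ContDiffAt.comp (f := fun y ↦ y - x) y (contDiffAt_coulombKernel hne) (by fun_prop)
  rw [h0, laplacian_eq_sum_of_contDiffAt h1]
  simp only [fderiv_comp_sub]
  have h2 := laplacian_coulombKernel hd hne
  rw [laplacian_eq_sum_of_contDiffAt (contDiffAt_coulombKernel hne)] at h2
  rw [← h2]
  refine Finset.sum_congr rfl fun i _ ↦ ?_
  rw [fderiv_comp_sub (f := fun z ↦ fderiv ℝ (coulombKernel d) z (stdVec i)) x]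

/-- For `|x| > s` the function `y ↦ w(x - y)` is harmonic near the closed ball of radius `s`, and
the mean value property applies after a cutoff. -/
lemma sphere_average_coulombKernel_of_lt {d : ℕ} (hd : 2 ≤ d) {x : Space d} {s : ℝ} (hs : 0 < s)
    (hx : s < ‖x‖) :
    ∫ ω, coulombKernel d (x - s • (ω : Space d)) ∂(sphereMeasure d) =
      (sphereMeasure d).real Set.univ * coulombProfile d ‖x‖ := by
  -- Both radii lie strictly between `s` and `|x|`: the product is unchanged near the ball of radius
  -- `s` and vanishes near the singularity `x`.
  let f : ContDiffBump (0 : Space d) :=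
    ⟨(s + ‖x‖) / 2, (s + 3 * ‖x‖) / 4, by linarith, by linarith⟩
  have hin : f.rIn = (s + ‖x‖) / 2 := rfl
  have hout : f.rOut = (s + 3 * ‖x‖) / 4 := rfl
  have hφ : IsTestFunction fun y ↦ f y * coulombKernel d (x - y) := by
    refine ⟨contDiff_iff_contDiffAt.2 fun y ↦ ?_, f.hasCompactSupport.mul_right⟩
    rcases eq_or_ne y x with rfl | hne
    · have h1 : (fun y' ↦ f y' * coulombKernel d (y - y')) =ᶠ[nhds y] fun _ ↦ 0 := by
        filter_upwards [(isOpen_lt continuous_const continuous_norm).mem_nhds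
          (show f.rOut < ‖y‖ by rw [hout]; linarith)] with z hz
        rw [f.zero_of_le_dist (by simpa using le_of_lt hz), zero_mul]
      exact contDiffAt_const.congr_of_eventuallyEq h1
    · exact f.contDiff.contDiffAt.mul (ContDiffAt.comp (f := fun y ↦ x - y) y
        (contDiffAt_coulombKernel (sub_ne_zero.2 hne.symm)) (by fun_prop))
  have heq : ∀ y : Space d, ‖y‖ ≤ f.rIn →
      f y * coulombKernel d (x - y) = coulombKernel d (x - y) := fun y hy ↦ by
    rw [f.one_of_mem_closedBall (by simpa using hy), one_mul]
  have h := sphere_average_eq_of_laplacian_eq_zero hd hφ hs fun y hy ↦ by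
    have h2 : (fun y ↦ f y * coulombKernel d (x - y)) =ᶠ[nhds y]
        fun y ↦ coulombKernel d (x - y) := by
      filter_upwards [(isOpen_lt continuous_norm continuous_const).mem_nhds
        (show ‖y‖ < f.rIn by rw [hin]; linarith)] with z hz
      exact heq z (le_of_lt hz)
    rw [(InnerProductSpace.laplacian_congr_nhds h2).eq_of_nhds]
    exact laplacian_coulombKernel_sub hd (by rintro rfl; linarith)
  rw [heq 0 (by rw [norm_zero]; exact f.rIn_pos.le)] at h
  rw [sub_zero] at h
  rw [← show coulombKernel d x = coulombProfile d ‖x‖ from rfl, ← h]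
  congr 1
  ext ω
  rw [heq _ (by rw [norm_smul, hin]; simp [abs_of_pos hs]; linarith)]

/-- This symmetry exchanges the radius of the sphere with that of the evaluation point, which
reduces a point inside the sphere to one outside. -/
lemma norm_smul_sub_smul_comm {d : ℕ} {e ω : Space d} (he : ‖e‖ = 1) (hω : ‖ω‖ = 1) (r s : ℝ) :
    ‖r • e - s • ω‖ = ‖s • e - r • ω‖ := by
  rw [← sq_eq_sq₀ (norm_nonneg _) (norm_nonneg _), norm_sub_sq_real, norm_sub_sq_real]
  simp only [norm_smul, inner_smul_left, inner_smul_right, he, hω]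
  simp
  ring

/-- Newton's theorem for a sphere. -/
lemma sphere_average_coulombKernel {d : ℕ} (hd : 2 ≤ d) {x : Space d} (hx : x ≠ 0) {s : ℝ}
    (hs : 0 < s) (hxs : s ≠ ‖x‖) :
    ∫ ω, coulombKernel d (x - s • (ω : Space d)) ∂(sphereMeasure d) =
      (sphereMeasure d).real Set.univ * coulombProfile d (max ‖x‖ s) := by
  rcases lt_or_gt_of_ne hxs with h | h
  · rw [max_eq_left h.le, sphere_average_coulombKernel_of_lt hd hs h]
  · have hn := norm_pos_iff.2 hx
    have he : ‖‖x‖⁻¹ • x‖ = 1 := by rw [norm_smul]; simp [hn.ne']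
    have hnorm : ‖s • ‖x‖⁻¹ • x‖ = s := by rw [norm_smul, he]; simp [abs_of_pos hs]
    have h1 := sphere_average_coulombKernel_of_lt hd (x := s • ‖x‖⁻¹ • x) hn (by rw [hnorm]; exact h)
    rw [hnorm] at h1
    rw [max_eq_right h.le, ← h1]
    congr 1
    ext ω
    have h2 := norm_smul_sub_smul_comm he (show ‖(ω : Space d)‖ = 1 by simp) ‖x‖ s
    rw [smul_smul ‖x‖, mul_inv_cancel₀ hn.ne', one_smul] at h2
    simp only [coulombKernel, h2]

/-! ### Potentials of radial densities. -/

/-- A radial probability density supported in the ball of radius `R`. -/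
structure IsRadialDensity {d : ℕ} (μ : Space d → ℝ) (R : ℝ) : Prop where
  radial : ∀ x y, ‖x‖ = ‖y‖ → μ x = μ y
  nonneg : ∀ x, 0 ≤ μ x
  support_subset : Function.support μ ⊆ Metric.closedBall 0 R
  integrable : Integrable μ
  integral_eq_one : ∫ x, μ x = 1

lemma IsRadialDensity.eq_zero {d : ℕ} {μ : Space d → ℝ} {R : ℝ} (hμ : IsRadialDensity μ R)
    {x : Space d} (hx : R < ‖x‖) : μ x = 0 := by
  by_contra h
  have := hμ.support_subset h
  simp at this
  linarith

lemma continuous_sphere_coulombKernel {d : ℕ} {x : Space d} {r : ℝ} (hr : 0 < r) (h : r ≠ ‖x‖) :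
    Continuous fun ω : Metric.sphere (0 : Space d) 1 ↦ coulombKernel d (x - r • (ω : Space d)) := by
  rw [continuous_iff_continuousAt]
  intro ω
  have hne : x - r • (ω : Space d) ≠ 0 := by
    intro h0
    rw [sub_eq_zero] at h0
    apply h
    rw [h0, norm_smul]
    simp [abs_of_pos hr]
  exact ContinuousAt.comp (f := fun ω : Metric.sphere (0 : Space d) 1 ↦ x - r • (ω : Space d))
    (contDiffAt_coulombKernel hne (n := 0)).continuousAt (by fun_prop)

lemma coulombProfile_zero {d : ℕ} (hd : 2 ≤ d) : coulombProfile d 0 = 0 := by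
  unfold coulombProfile
  split_ifs with h
  · simp
  · simp [zero_pow (show d - 2 ≠ 0 by omega)]

lemma neg_abs_le_coulombKernel {d : ℕ} (hd : 2 ≤ d) {z : Space d} {t : ℝ} (h : ‖z‖ ≤ t) :
    -|coulombProfile d t| ≤ coulombKernel d z := by
  rcases eq_or_ne z 0 with rfl | hz
  · simp [coulombKernel, coulombProfile_zero hd]
  · exact (neg_abs_le _).trans (coulombProfile_anti (norm_pos_iff.2 hz) h)

lemma IsRadialDensity.ae_sphere {d : ℕ} (hd : 2 ≤ d) {μ : Space d → ℝ} {R : ℝ}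
    (hμ : IsRadialDensity μ R) (r : ℝ) :
    ∃ c, 0 ≤ c ∧ ∀ ω : Metric.sphere (0 : Space d) 1, μ (r • (ω : Space d)) = c := by
  have := nontrivial_space hd
  obtain ⟨e⟩ : Nonempty (Metric.sphere (0 : Space d) 1) :=
    (NormedSpace.sphere_nonempty.2 zero_le_one).to_subtype
  exact ⟨μ (r • (e : Space d)), hμ.nonneg _, fun ω ↦ hμ.radial _ _ (by simp [norm_smul])⟩

/-- On the relevant range `w ≥ -c`, so `|w| ≤ w + 2c`, and the spherical averages of the right side
are known from Newton's theorem. No boundedness of `μ` is needed. -/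
lemma IsRadialDensity.integrable_coulombKernel {d : ℕ} (hd : 2 ≤ d) {μ : Space d → ℝ} {R : ℝ}
    (hμ : IsRadialDensity μ R) {x : Space d} (hx : x ≠ 0) :
    Integrable fun y ↦ coulombKernel d (x - y) * μ y := by
  have hmeas : AEStronglyMeasurable fun y ↦ coulombKernel d (x - y) * μ y :=
    ((measurable_coulombKernel d).comp (measurable_const.sub measurable_id)).aestronglyMeasurable.mul
      hμ.integrable.1
  have hpol := measurePreserving_polar hd
  have hmeas' := hmeas.comp_measurePreserving hpol
  rw [← hpol.integrable_comp hmeas, integrable_prod_iff' hmeas']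
  set c := |coulombProfile d (‖x‖ + R)|
  constructor
  · filter_upwards [ae_radialMeasure_pos d, ae_radialMeasure_ne d ‖x‖] with r hr hrx
    obtain ⟨m, hm, hmω⟩ := hμ.ae_sphere hd r
    simp only [Function.comp_def, hmω]
    exact ((continuous_sphere_coulombKernel hr hrx).integrable_of_hasCompactSupport
      (HasCompactSupport.of_compactSpace _)).mul_const m
  · have hint := (integrable_polar hd hμ.integrable).integral_prod_right.const_mul
      (|coulombProfile d ‖x‖| + 2 * c)
    refine hint.mono' hmeas'.norm.prod_swap.integral_prod_right' ?_
    filter_upwards [ae_radialMeasure_pos d, ae_radialMeasure_ne d ‖x‖] with r hr hrx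
    obtain ⟨m, hm, hmω⟩ := hμ.ae_sphere hd r
    simp only [Function.comp_def, hmω]
    rw [Real.norm_of_nonneg (integral_nonneg fun _ ↦ norm_nonneg _)]
    rcases lt_or_ge R r with hR | hR
    · have : Nonempty (Metric.sphere (0 : Space d) 1) := by
        have := nontrivial_space hd
        exact (NormedSpace.sphere_nonempty.2 zero_le_one).to_subtype
      have hm0 : m = 0 := by
        rw [← hmω (Classical.arbitrary _)]
        exact hμ.eq_zero (by simp [norm_smul, abs_of_pos hr, hR])
      simp [hm0]
    · have hci := (continuous_sphere_coulombKernel hr hrx).integrable_of_hasCompactSupport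
        (μ := sphereMeasure d) (HasCompactSupport.of_compactSpace _)
      have hle : ∫ ω, ‖coulombKernel d (x - r • (ω : Space d)) * m‖ ∂(sphereMeasure d) ≤
          ∫ ω, (coulombKernel d (x - r • (ω : Space d)) + 2 * c) * m ∂(sphereMeasure d) := by
        refine integral_mono (hci.mul_const m).norm ((hci.add (integrable_const _)).mul_const m)
          fun ω ↦ ?_
        simp only [norm_mul, Real.norm_eq_abs, abs_of_nonneg hm]
        refine mul_le_mul_of_nonneg_right ?_ hm
        have h1 : -c ≤ coulombKernel d (x - r • (ω : Space d)) := by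
          refine neg_abs_le_coulombKernel hd ((norm_sub_le _ _).trans ?_)
          simp [norm_smul, abs_of_pos hr, hR]
        have h2 : 0 ≤ c := abs_nonneg _
        rw [abs_le]
        constructor <;> linarith
      refine hle.trans ?_
      rw [integral_mul_const, integral_add hci (integrable_const _),
        sphere_average_coulombKernel hd hx hr hrx]
      simp only [integral_const, smul_eq_mul]
      have h3 : coulombProfile d (max ‖x‖ r) ≤ |coulombProfile d ‖x‖| :=
        (coulombProfile_anti (norm_pos_iff.2 hx) (le_max_left _ _)).trans (le_abs_self _)
      have h4 : 0 ≤ (sphereMeasure d).real Set.univ := measureReal_nonneg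
      have h5 := mul_le_mul_of_nonneg_left h3 (mul_nonneg h4 hm)
      nlinarith

lemma IsRadialDensity.integrable_profile {d : ℕ} (hd : 2 ≤ d) {μ : Space d → ℝ} {R : ℝ}
    (hμ : IsRadialDensity μ R) {r : ℝ} (hr : 0 < r) :
    Integrable fun y ↦ coulombProfile d (max r ‖y‖) * μ y := by
  have hc : Continuous fun y : Space d ↦ coulombProfile d (max r ‖y‖) := by
    have := (lipschitzWith_truncated_profile hd hr).continuous.comp
      (continuous_norm (E := Space d))
    simpa [Function.comp_def, max_comm] using this
  obtain ⟨C, hC⟩ := (isCompact_closedBall (0 : Space d) R).exists_bound_of_continuousOn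
    hc.continuousOn
  refine (hμ.integrable.norm.const_mul C).mono'
    (hc.aestronglyMeasurable.mul hμ.integrable.1) (ae_of_all _ fun y ↦ ?_)
  by_cases hy : y ∈ Metric.closedBall (0 : Space d) R
  · rw [norm_mul]
    exact mul_le_mul_of_nonneg_right (hC y hy) (norm_nonneg _)
  · rw [hμ.eq_zero (by simpa using hy)]
    simp

/-- Newton's theorem for a radial density. -/
lemma IsRadialDensity.integral_coulombKernel {d : ℕ} (hd : 2 ≤ d) {μ : Space d → ℝ} {R : ℝ}
    (hμ : IsRadialDensity μ R) {x : Space d} (hx : x ≠ 0) :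
    ∫ y, coulombKernel d (x - y) * μ y = ∫ y, coulombProfile d (max ‖x‖ ‖y‖) * μ y := by
  rw [integral_polar hd (hμ.integrable_coulombKernel hd hx),
    integral_polar hd (hμ.integrable_profile hd (norm_pos_iff.2 hx))]
  refine integral_congr_ae ?_
  filter_upwards [ae_radialMeasure_pos d, ae_radialMeasure_ne d ‖x‖] with r hr hrx
  obtain ⟨m, hm, hmω⟩ := hμ.ae_sphere hd r
  simp only [hmω]
  rw [integral_mul_const, sphere_average_coulombKernel hd hx hr hrx]
  simp [norm_smul, abs_of_pos hr, mul_assoc]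

/-- By Newton's theorem the potential averages `w(max(|x|, |y|))`, and `w` is decreasing. The bound
does not see `μ`, which is what makes the final constant independent of `ρ` and `η`. -/
lemma IsRadialDensity.potential_le {d : ℕ} (hd : 2 ≤ d) {μ : Space d → ℝ} {R : ℝ}
    (hμ : IsRadialDensity μ R) {x : Space d} (hx : x ≠ 0) :
    ∫ y, coulombKernel d (x - y) * μ y ≤ coulombKernel d x := by
  rw [hμ.integral_coulombKernel hd hx]
  calc _ ≤ ∫ y, coulombKernel d x * μ y := by
        refine integral_mono (hμ.integrable_profile hd (norm_pos_iff.2 hx))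
          (hμ.integrable.const_mul _) fun y ↦ ?_
        exact mul_le_mul_of_nonneg_right (coulombProfile_anti (norm_pos_iff.2 hx)
          (le_max_left _ _)) (hμ.nonneg y)
    _ = _ := by rw [integral_const_mul, hμ.integral_eq_one, mul_one]

/-! ### The gradient of `w * μ - w` and its divergence. -/

/-- The mass of `μ` outside the closed ball of radius `r`. -/
def tailMass {d : ℕ} (μ : Space d → ℝ) (r : ℝ) : ℝ := ∫ y in {y | r < ‖y‖}, μ y

lemma measurableSet_lt_norm {d : ℕ} (r : ℝ) : MeasurableSet {y : Space d | r < ‖y‖} :=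
  (isOpen_lt continuous_const continuous_norm).measurableSet

lemma measurableSet_norm_le {d : ℕ} (r : ℝ) : MeasurableSet {y : Space d | ‖y‖ ≤ r} :=
  (isClosed_le continuous_norm continuous_const).measurableSet

namespace IsRadialDensity

variable {d : ℕ} {μ : Space d → ℝ} {R : ℝ}

lemma tailMass_add (hμ : IsRadialDensity μ R) (r : ℝ) :
    tailMass μ r + ∫ y in {y | ‖y‖ ≤ r}, μ y = 1 := by
  have h := integral_add_compl (measurableSet_lt_norm (d := d) r) hμ.integrable
  rw [hμ.integral_eq_one] at h
  rw [← h, tailMass]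
  congr 3
  ext y
  simp

lemma tailMass_nonneg (hμ : IsRadialDensity μ R) (r : ℝ) : 0 ≤ tailMass μ r :=
  setIntegral_nonneg (measurableSet_lt_norm r) fun y _ ↦ hμ.nonneg y

lemma tailMass_le_one (hμ : IsRadialDensity μ R) (r : ℝ) : tailMass μ r ≤ 1 := by
  have := hμ.tailMass_add r
  have h2 : 0 ≤ ∫ y in {y : Space d | ‖y‖ ≤ r}, μ y :=
    setIntegral_nonneg (measurableSet_norm_le r) fun y _ ↦ hμ.nonneg y
  linarith

lemma antitone_tailMass (hμ : IsRadialDensity μ R) : Antitone (tailMass μ) := fun _ s hrs ↦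
  setIntegral_mono_set hμ.integrable.integrableOn (ae_of_all _ hμ.nonneg)
    (LE.le.eventuallyLE fun y (hy : s < ‖y‖) ↦ lt_of_le_of_lt hrs hy)

lemma tailMass_eq_zero (hμ : IsRadialDensity μ R) {r : ℝ} (hr : R ≤ r) : tailMass μ r = 0 :=
  setIntegral_eq_zero_of_forall_eq_zero fun _ hy ↦ hμ.eq_zero (lt_of_le_of_lt hr hy)

/-- Gauss's law: only the mass within radius `r` acts. Near `r` the integrand may be frozen below `r
/ 2`, which gives the Lipschitz bound for differentiating under the integral. -/
lemma hasDerivAt_radial_potential (hd : 2 ≤ d) (hμ : IsRadialDensity μ R) {r : ℝ} (hr : 0 < r) :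
    HasDerivAt (fun r ↦ ∫ y, coulombProfile d (max r ‖y‖) * μ y)
      (-coulombSlope d / r ^ (d - 1) * (1 - tailMass μ r)) r := by
  have hlip := lipschitzWith_truncated_profile hd (half_pos hr)
  set C := Real.toNNReal (coulombSlope d / (r / 2) ^ (d - 1))
  have h := (hasDerivAt_integral_of_dominated_loc_of_lip (μ := volume) (x₀ := r)
    (F := fun r y ↦ coulombProfile d (max r ‖y‖) * μ y)
    (F' := fun y ↦ -coulombSlope d / r ^ (d - 1) * {y | ‖y‖ ≤ r}.indicator μ y)
    (bound := fun y ↦ C * μ y) (s := Set.Ioi (r / 2)) (Ioi_mem_nhds (by linarith)) ?_ ?_ ?_ ?_ ?_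
    ?_).2
  · rw [integral_const_mul, integral_indicator (measurableSet_norm_le r)] at h
    rwa [← hμ.tailMass_add r, add_sub_cancel_left]
  · filter_upwards [Ioi_mem_nhds hr] with s hs
    exact (hμ.integrable_profile hd hs).1
  · exact hμ.integrable_profile hd hr
  · exact (hμ.integrable.1.indicator (measurableSet_norm_le r)).const_mul _
  · refine ae_of_all _ fun y ↦ ?_
    refine LipschitzOnWith.of_dist_le_mul fun s hs t ht ↦ ?_
    have h1 := hlip.dist_le_mul (max s ‖y‖) (max t ‖y‖)
    rw [max_eq_left ((le_of_lt hs).trans (le_max_left s ‖y‖)),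
      max_eq_left ((le_of_lt ht).trans (le_max_left t ‖y‖))] at h1
    have h2 : dist (max s ‖y‖) (max t ‖y‖) ≤ dist s t := by
      simpa using (LipschitzWith.id.max_const ‖y‖).dist_le_mul s t
    rw [Real.dist_eq, ← sub_mul, abs_mul, abs_of_nonneg (hμ.nonneg y), ← Real.dist_eq]
    have h3 : ((Real.nnabs (C * μ y) : NNReal) : ℝ) = C * μ y := by
      simp [abs_of_nonneg (hμ.nonneg y)]
    rw [h3]
    calc _ ≤ C * dist (max s ‖y‖) (max t ‖y‖) * μ y :=
          mul_le_mul_of_nonneg_right h1 (hμ.nonneg y)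
      _ ≤ C * dist s t * μ y := by
          gcongr
          exact hμ.nonneg y
      _ = _ := by ring
  · exact hμ.integrable.const_mul _
  · filter_upwards [ae_norm_ne hd r] with y hy
    rcases lt_or_gt_of_ne hy with h | h
    · rw [Set.indicator_of_mem (by exact h.le)]
      refine HasDerivAt.mul_const ?_ _
      refine (hasDerivAt_coulombProfile hd hr).congr_of_eventuallyEq ?_
      filter_upwards [Ioi_mem_nhds h] with s hs
      rw [max_eq_left (le_of_lt hs)]
    · rw [Set.indicator_of_notMem (by simpa using h), mul_zero]
      refine (hasDerivAt_const r (coulombProfile d ‖y‖ * μ y)).congr_of_eventuallyEq ?_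
      filter_upwards [Iio_mem_nhds h] with s hs
      rw [max_eq_right (le_of_lt hs)]

end IsRadialDensity

/-- The gradient of `w * μ - w` for a radial probability density `μ`. -/
def radialField {d : ℕ} (μ : Space d → ℝ) (x : Space d) : Space d :=
  (coulombSlope d * tailMass μ ‖x‖ * (‖x‖ ^ d)⁻¹) • x

namespace IsRadialDensity

variable {d : ℕ} {μ : Space d → ℝ} {R : ℝ}

lemma gradient_potential_sub (hd : 2 ≤ d) (hμ : IsRadialDensity μ R) {x : Space d} (hx : x ≠ 0) :
    gradient (fun x ↦ (∫ y, coulombKernel d (x - y) * μ y) - coulombKernel d x) x =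
      radialField μ x := by
  have hn := norm_pos_iff.2 hx
  have h1 := hasFDerivAt_profile_norm hx ((hμ.hasDerivAt_radial_potential hd hn).sub
    (hasDerivAt_coulombProfile hd hn))
  have h2 : (fun x ↦ (∫ y, coulombKernel d (x - y) * μ y) - coulombKernel d x) =ᶠ[nhds x]
      fun x ↦ (∫ y, coulombProfile d (max ‖x‖ ‖y‖) * μ y) - coulombProfile d ‖x‖ := by
    filter_upwards [isOpen_ne.mem_nhds hx] with z hz
    rw [hμ.integral_coulombKernel hd hz]
    rfl
  have h3 := h1.congr_of_eventuallyEq h2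
  have h4 : HasGradientAt (fun x ↦ (∫ y, coulombKernel d (x - y) * μ y) - coulombKernel d x)
      (radialField μ x) x := by
    rw [hasGradientAt_iff_hasFDerivAt]
    convert! h3 using 1
    ext v
    have h3 : ‖x‖ ^ d = ‖x‖ ^ (d - 1) * ‖x‖ := by rw [← pow_succ, Nat.sub_add_cancel (by omega)]
    simp only [radialField, map_smul, smul_apply, smul_eq_mul, h3,
      InnerProductSpace.toDual_apply_apply, innerSL_apply_apply]
    field_simp
    ring
  exact h4.gradient

lemma norm_radialField_le (hd : 2 ≤ d) (hμ : IsRadialDensity μ R) (x : Space d) :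
    ‖radialField μ x‖ ≤ coulombSlope d * (Metric.ball (0 : Space d) R).indicator
      (fun x ↦ (‖x‖ ^ (d - 1))⁻¹) x := by
  have hk := coulombSlope_pos hd
  by_cases hx : x ∈ Metric.ball (0 : Space d) R
  · rw [Set.indicator_of_mem hx, radialField, norm_smul, norm_mul, norm_mul,
      Real.norm_of_nonneg hk.le, Real.norm_of_nonneg (hμ.tailMass_nonneg _),
      Real.norm_of_nonneg (by positivity)]
    have h1 : (‖x‖ ^ d)⁻¹ * ‖x‖ ≤ (‖x‖ ^ (d - 1))⁻¹ := by
      rcases eq_or_ne x 0 with rfl | h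
      · simp
      · have hn := norm_pos_iff.2 h
        have h3 : ‖x‖ ^ d = ‖x‖ ^ (d - 1) * ‖x‖ := by
          rw [← pow_succ, Nat.sub_add_cancel (by omega)]
        rw [h3]
        apply le_of_eq
        field_simp
    calc _ = coulombSlope d * (tailMass μ ‖x‖ * ((‖x‖ ^ d)⁻¹ * ‖x‖)) := by ring
      _ ≤ coulombSlope d * (1 * (‖x‖ ^ (d - 1))⁻¹) := by
          gcongr
          exact hμ.tailMass_le_one _
      _ = _ := by ring
  · rw [Set.indicator_of_notMem hx, radialField, hμ.tailMass_eq_zero (by simpa using hx)]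
    simp

lemma radialField_eq_zero (hμ : IsRadialDensity μ R) {x : Space d} (hx : R ≤ ‖x‖) :
    radialField μ x = 0 := by
  rw [radialField, hμ.tailMass_eq_zero hx]
  simp

lemma measurable_radialField (hμ : IsRadialDensity μ R) : Measurable (radialField μ) := by
  unfold radialField
  exact (((hμ.antitone_tailMass.measurable.comp measurable_norm).const_mul _).mul
    (measurable_norm.pow_const d).inv).smul measurable_id

lemma integrable_radialField (hd : 2 ≤ d) (hμ : IsRadialDensity μ R) :
    Integrable (radialField μ) :=
  ((integrable_indicator_inv_norm_pow hd R).const_mul _).mono'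
    hμ.measurable_radialField.aestronglyMeasurable (ae_of_all _ (hμ.norm_radialField_le hd))

lemma integral_sphere_average_mul (hd : 2 ≤ d) (hμ : IsRadialDensity μ R) {φ : Space d → ℝ}
    (hφ : IsTestFunction φ) :
    ∫ y, μ y * ∫ ω, φ (‖y‖ • (ω : Space d)) ∂(sphereMeasure d) =
      (sphereMeasure d).real Set.univ * ∫ y, μ y * φ y := by
  obtain ⟨C, hC⟩ := hφ.2.exists_bound_of_continuous hφ.continuous
  have h1 : Integrable fun y ↦ μ y * φ y :=
    hμ.integrable.mul_bdd hφ.continuous.aestronglyMeasurable (ae_of_all _ hC)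
  have h2 : Integrable fun y ↦ μ y * ∫ ω, φ (‖y‖ • (ω : Space d)) ∂(sphereMeasure d) := by
    refine hμ.integrable.mul_bdd ((continuous_sphere_average hφ).comp
      continuous_norm).aestronglyMeasurable (c := C * (sphereMeasure d).real Set.univ)
        (ae_of_all _ fun y ↦ ?_)
    exact norm_integral_le_of_norm_le_const (ae_of_all _ fun ω ↦ hC _)
  rw [integral_polar hd h1, integral_polar hd h2, ← integral_const_mul]
  refine integral_congr_ae ?_
  filter_upwards [ae_radialMeasure_pos d] with r hr
  obtain ⟨m, hm, hmω⟩ := hμ.ae_sphere hd r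
  simp only [hmω, norm_smul]
  simp only [Real.norm_of_nonneg hr.le, norm_eq_of_mem_sphere, mul_one, integral_const,
    smul_eq_mul, integral_const_mul]

end IsRadialDensity

lemma IsTestFunction.integrable_radial_fderiv {d : ℕ} (hd : 2 ≤ d) {φ : Space d → ℝ}
    (hφ : IsTestFunction φ) : Integrable fun x ↦ (‖x‖ ^ d)⁻¹ * fderiv ℝ φ x x := by
  obtain ⟨S, -, -, hsupp⟩ := exists_ball_of_hasCompactSupport hφ.2 0
  refine (integrableOn_iff_integrable_of_support_subset fun x hx ↦ hsupp ?_).1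
    (integrableOn_radial_fderiv hd (hφ.contDiff_nat 1) S)
  by_contra h
  refine hx ?_
  have h0 : fderiv ℝ φ x = 0 :=
    image_eq_zero_of_notMem_tsupport (fun h' ↦ h (tsupport_fderiv_subset ℝ h'))
  simp [h0]

lemma IsTestFunction.integrable_sphere {d : ℕ} {φ : Space d → ℝ} (hφ : IsTestFunction φ) (t : ℝ) :
    Integrable (fun ω : Metric.sphere (0 : Space d) 1 ↦ φ (t • (ω : Space d)))
      (sphereMeasure d) :=
  (hφ.continuous.comp (f := fun ω : Metric.sphere (0 : Space d) 1 ↦ t • (ω : Space d))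
    (by fun_prop)).integrable_of_hasCompactSupport (HasCompactSupport.of_compactSpace _)

/-- `-div (∇ (w * μ - w)) = c_d (μ - δ₀)`. -/
lemma IsRadialDensity.integral_fderiv_radialField {d : ℕ} {μ : Space d → ℝ} {R : ℝ} (hd : 2 ≤ d)
    (hμ : IsRadialDensity μ R) {φ : Space d → ℝ} (hφ : IsTestFunction φ) :
    ∫ x, fderiv ℝ φ x (radialField μ x) = coulombConst d * ((∫ y, μ y * φ y) - φ 0) := by
  set Q : Space d → ℝ := fun x ↦ (‖x‖ ^ d)⁻¹ * fderiv ℝ φ x x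
  have hQ : Integrable Q := hφ.integrable_radial_fderiv hd
  have hset : MeasurableSet {z : Space d × Space d | ‖z.1‖ < ‖z.2‖} :=
    (isOpen_lt (by fun_prop) (by fun_prop)).measurableSet
  have hG : Integrable ({z : Space d × Space d | ‖z.1‖ < ‖z.2‖}.indicator
      fun z ↦ Q z.1 * μ z.2) (volume.prod volume) := (hQ.mul_prod hμ.integrable).indicator hset
  obtain ⟨C, hC⟩ := hφ.2.exists_bound_of_continuous hφ.continuous
  -- Writing the tail mass as an integral over `|y| > |x|` and exchanging the integrals reduces the
  -- claim to balls of radius `|y|`, weighted by `μ y`.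
  have hx : ∀ x, fderiv ℝ φ x (radialField μ x) = coulombSlope d *
      ∫ y, {z : Space d × Space d | ‖z.1‖ < ‖z.2‖}.indicator (fun z ↦ Q z.1 * μ z.2) (x, y) := by
    intro x
    have : ∀ y, {z : Space d × Space d | ‖z.1‖ < ‖z.2‖}.indicator (fun z ↦ Q z.1 * μ z.2) (x, y)
        = Q x * {y | ‖x‖ < ‖y‖}.indicator μ y := fun y ↦ by
      by_cases h : ‖x‖ < ‖y‖
      · rw [Set.indicator_of_mem (by exact h), Set.indicator_of_mem (by exact h)]
      · rw [Set.indicator_of_notMem (by exact h), Set.indicator_of_notMem (by exact h), mul_zero]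
    simp only [this]
    rw [integral_const_mul, integral_indicator (measurableSet_lt_norm _)]
    simp only [radialField, map_smul, smul_eq_mul, tailMass, Q]
    ring
  have hy : ∀ y ≠ 0, ∫ x, {z : Space d × Space d | ‖z.1‖ < ‖z.2‖}.indicator
      (fun z ↦ Q z.1 * μ z.2) (x, y) =
        μ y * (∫ ω, φ (‖y‖ • (ω : Space d)) ∂(sphereMeasure d)) -
          (sphereMeasure d).real Set.univ * φ 0 * μ y := by
    intro y hy
    have : ∀ x, {z : Space d × Space d | ‖z.1‖ < ‖z.2‖}.indicator (fun z ↦ Q z.1 * μ z.2) (x, y)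
        = (Metric.ball 0 ‖y‖).indicator Q x * μ y := fun x ↦ by
      by_cases h : ‖x‖ < ‖y‖
      · rw [Set.indicator_of_mem (by exact h), Set.indicator_of_mem (by simpa using h)]
      · rw [Set.indicator_of_notMem (by exact h), Set.indicator_of_notMem (by simpa using h),
          zero_mul]
    simp only [this]
    rw [integral_mul_const, integral_indicator Metric.isOpen_ball.measurableSet,
      setIntegral_ball_radial_fderiv hd (hφ.contDiff_nat 1) (norm_pos_iff.2 hy),
      integral_sub (hφ.integrable_sphere _) (integrable_const _)]
    simp only [integral_const, smul_eq_mul]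
    ring
  have hi : Integrable fun y ↦ μ y * ∫ ω, φ (‖y‖ • (ω : Space d)) ∂(sphereMeasure d) := by
    refine hμ.integrable.mul_bdd ((continuous_sphere_average hφ).comp
      continuous_norm).aestronglyMeasurable (c := C * (sphereMeasure d).real Set.univ)
        (ae_of_all _ fun y ↦ ?_)
    exact norm_integral_le_of_norm_le_const (ae_of_all _ fun ω ↦ hC _)
  simp only [hx]
  rw [integral_const_mul, integral_integral_swap (f := fun x y ↦ {z : Space d × Space d | ‖z.1‖ < ‖z.2‖}.indicator
    (fun z ↦ Q z.1 * μ z.2) (x, y)) hG]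
  have hcongr : (fun y ↦ ∫ x, {z : Space d × Space d | ‖z.1‖ < ‖z.2‖}.indicator
      (fun z ↦ Q z.1 * μ z.2) (x, y)) =ᵐ[volume] fun y ↦
        μ y * (∫ ω, φ (‖y‖ • (ω : Space d)) ∂(sphereMeasure d)) -
          (sphereMeasure d).real Set.univ * φ 0 * μ y := by
    filter_upwards [ae_ne_zero hd] with y h0 using hy y h0
  rw [integral_congr_ae hcongr, integral_sub hi (hμ.integrable.const_mul _),
    hμ.integral_sphere_average_mul hd hφ, integral_const_mul, hμ.integral_eq_one, coulombConst_eq]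
  ring

/-! ### The smeared field and its divergence equation. -/

lemma isRadialDensity_smearedCharge {d : ℕ} {ρ : Space d → ℝ} (hρ : IsSmearingProfile ρ) {η : ℝ}
    (hη : 0 < η) : IsRadialDensity (smearedCharge ρ η) η where
  radial x y h := by
    unfold smearedCharge
    rw [hρ.radial (η⁻¹ • x) (η⁻¹ • y) (by rw [norm_smul, norm_smul, h])]
  nonneg x := mul_nonneg (by positivity) (hρ.nonneg _)
  support_subset x hx := by
    have h1 : η⁻¹ • x ∈ Function.support ρ := fun h ↦ hx (by simp [smearedCharge, h])
    have h2 := hρ.support_subset h1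
    rw [mem_closedBall_zero_iff, norm_smul, Real.norm_of_nonneg (by positivity),
      inv_mul_le_iff₀ hη, mul_one] at h2
    simpa using h2
  integrable := (hρ.integrable.comp_smul (inv_ne_zero hη.ne')).const_mul _
  integral_eq_one := by
    unfold smearedCharge
    rw [integral_const_mul, Measure.integral_comp_inv_smul_of_nonneg _ _ hη.le,
      hρ.integral_eq_one, finrank_euclideanSpace_fin]
    simp [(pow_pos hη d).ne']

lemma gradient_smearingPotential {d : ℕ} (hd : 2 ≤ d) {ρ : Space d → ℝ}
    (hρ : IsSmearingProfile ρ) {η : ℝ} (hη : 0 < η) {x : Space d} (hx : x ≠ 0) :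
    gradient (smearingPotential ρ η) x = radialField (smearedCharge ρ η) x :=
  (isRadialDensity_smearedCharge hρ hη).gradient_potential_sub hd hx

/-- Each `∇f_η(· - q)` vanishes at distance `η` or more from `q`, so charges beyond radius `S + η`
do not matter. Points of `F` are excluded because `gradient` is identified only away from the
singularity. -/
lemma smearedField_eq {d : ℕ} (hd : 2 ≤ d) {ρ : Space d → ℝ} (hρ : IsSmearingProfile ρ) {η : ℝ}
    (hη : 0 < η) (E : Space d → Space d) {N : Space d → ℕ} {S : ℝ} {F : Finset (Space d)}
    (hF : ∀ q, N q ≠ 0 → ‖q‖ ≤ S + η → q ∈ F) {x : Space d} (hx : ‖x‖ ≤ S) (hxF : x ∉ F) :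
    smearedField ρ η E N x =
      E x + ∑ q ∈ F, (N q : ℝ) • radialField (smearedCharge ρ η) (x - q) := by
  unfold smearedField
  congr 1
  rw [finsum_eq_sum_of_support_subset (s := F)]
  · refine Finset.sum_congr rfl fun q hq ↦ ?_
    rw [gradient_smearingPotential hd hρ hη (sub_ne_zero.2 fun h : x = q ↦ hxF (h ▸ hq))]
  · intro q hq
    by_contra hqF
    refine hq ?_
    by_cases hN : N q = 0
    · simp [hN]
    · have h1 : S + η < ‖q‖ := by
        by_contra h
        exact hqF (hF q hN (not_lt.1 h))
      have h2 : η < ‖x - q‖ := by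
        have := norm_sub_norm_le q x
        rw [norm_sub_rev] at this
        linarith
      have h3 : x - q ≠ 0 := norm_pos_iff.1 (hη.trans h2)
      simp only [gradient_smearingPotential hd hρ hη h3,
        (isRadialDensity_smearedCharge hρ hη).radialField_eq_zero h2.le, smul_zero]

lemma continuous_gradient {d : ℕ} {φ : Space d → ℝ} (hφ : ContDiff ℝ 1 φ) :
    Continuous (gradient φ) :=
  (InnerProductSpace.toDual ℝ (Space d)).symm.continuous.comp (hφ.continuous_fderiv (by simp))

lemma gradient_apply {d : ℕ} (φ : Space d → ℝ) (x : Space d) (i : Fin d) :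
    gradient φ x i = fderiv ℝ φ x (stdVec i) := by
  rw [← inner_gradient_left, show stdVec i = EuclideanSpace.single i (1 : ℝ) from
    EuclideanSpace.basisFun_apply _ _ _, EuclideanSpace.inner_single_right]
  simp

lemma hasCompactSupport_gradient {d : ℕ} {φ : Space d → ℝ} (hφ : HasCompactSupport φ) :
    HasCompactSupport (gradient φ) :=
  (hφ.fderiv ℝ).comp_left (map_zero (InnerProductSpace.toDual ℝ (Space d)).symm)

lemma IsTestFunction.integrable_fderiv_apply {d : ℕ} {φ : Space d → ℝ} (hφ : IsTestFunction φ)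
    {E : Space d → Space d} (hE : LocallyIntegrable E) :
    Integrable fun x ↦ fderiv ℝ φ x (E x) := by
  simp_rw [fun x ↦ fderiv_apply_eq_sum φ x (E x)]
  refine integrable_finsetSum _ fun i _ ↦ ?_
  have h := hE.integrable_smul_left_of_hasCompactSupport (hφ.fderiv_apply (stdVec i)).continuous
    (hφ.fderiv_apply (stdVec i)).2
  simpa [mul_comm] using (EuclideanSpace.proj i : Space d →L[ℝ] ℝ).integrable_comp h

/-- The weak gradient identity is applied to each `∂_i φ`; its `i`-th coordinates sum to the
Laplacian. -/
lemma IsWeakGradient.integral_fderiv_apply {d : ℕ} {h : Space d → ℝ} {E : Space d → Space d}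
    (hhE : IsWeakGradient h E) (hh : LocallyIntegrable h) (hE : LocallyIntegrable E)
    {φ : Space d → ℝ} (hφ : IsTestFunction φ) :
    ∫ x, fderiv ℝ φ x (E x) = -∫ x, h x * Laplacian.laplacian φ x := by
  have hint : ∀ i : Fin d, Integrable fun x ↦ fderiv ℝ φ x (stdVec i) • E x := fun i ↦
    hE.integrable_smul_left_of_hasCompactSupport (hφ.fderiv_apply (stdVec i)).continuous
      (hφ.fderiv_apply (stdVec i)).2
  have hint2 : ∀ i : Fin d, Integrable fun x ↦
      h x • gradient (fun y ↦ fderiv ℝ φ y (stdVec i)) x := fun i ↦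
    hh.integrable_smul_right_of_hasCompactSupport
      (continuous_gradient ((hφ.fderiv_apply _).contDiff_nat 1))
      (hasCompactSupport_gradient (hφ.fderiv_apply _).2)
  have hcoord : ∀ i : Fin d, ∫ x, h x * fderiv ℝ (fun y ↦ fderiv ℝ φ y (stdVec i)) x (stdVec i) =
      -∫ x, E x i * fderiv ℝ φ x (stdVec i) := fun i ↦ by
    have h1 := congrArg (EuclideanSpace.proj i : Space d →L[ℝ] ℝ) (hhE _ (hφ.fderiv_apply (stdVec i)))
    rw [map_neg, ← ContinuousLinearMap.integral_comp_comm _ (hint2 i),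
      ← ContinuousLinearMap.integral_comp_comm _ (hint i)] at h1
    simpa [gradient_apply, mul_comm] using h1
  simp_rw [fun x ↦ fderiv_apply_eq_sum φ x (E x)]
  rw [hφ.laplacian_eq]
  simp only [Finset.mul_sum]
  rw [integral_finsetSum, integral_finsetSum, ← Finset.sum_neg_distrib]
  · refine Finset.sum_congr rfl fun i _ ↦ ?_
    rw [hcoord i, neg_neg]
  · intro i _
    simpa [gradient_apply] using (EuclideanSpace.proj i : Space d →L[ℝ] ℝ).integrable_comp (hint2 i)
  · intro i _
    simpa [mul_comm] using (EuclideanSpace.proj i : Space d →L[ℝ] ℝ).integrable_comp (hint i)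

lemma IsTestFunction.fderiv_eq_zero {d : ℕ} {φ : Space d → ℝ} {S : ℝ}
    (hS : tsupport φ ⊆ Metric.closedBall 0 S) {x : Space d} (hx : S < ‖x‖) : fderiv ℝ φ x = 0 :=
  image_eq_zero_of_notMem_tsupport fun h ↦ by
    have := hS (tsupport_fderiv_subset ℝ h)
    simp at this
    linarith

lemma IsRadialDensity.integral_fderiv_radialField_sub {d : ℕ} {μ : Space d → ℝ} {R : ℝ}
    (hd : 2 ≤ d) (hμ : IsRadialDensity μ R) {φ : Space d → ℝ} (hφ : IsTestFunction φ)
    (q : Space d) :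
    ∫ x, fderiv ℝ φ x (radialField μ (x - q)) =
      coulombConst d * ((∫ x, μ (x - q) * φ x) - φ q) := by
  have h := hμ.integral_fderiv_radialField hd (hφ.comp_add_right q)
  simp only [fderiv_comp_add_right, zero_add] at h
  rw [← integral_sub_right_eq_self (fun x ↦ fderiv ℝ φ (x + q) (radialField μ x)) q,
    ← integral_sub_right_eq_self (fun y ↦ μ y * φ (y + q)) q] at h
  simpa using h

/-- The smeared field solves `div E_η = c_d (1 - ∑ N_p δ_p^{(η)})`. -/
lemma integral_fderiv_smearedField {d : ℕ} (hd : 2 ≤ d) {ρ : Space d → ℝ}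
    (hρ : IsSmearingProfile ρ) {η : ℝ} (hη : 0 < η) {E : Space d → Space d} {N : Space d → ℕ}
    (hE : IsAdmissibleField 1 E N) {S : ℝ} {F : Finset (Space d)}
    (hF : ∀ q, N q ≠ 0 → ‖q‖ ≤ S + η → q ∈ F) {φ : Space d → ℝ} (hφ : IsTestFunction φ)
    (hS : tsupport φ ⊆ Metric.closedBall 0 S) :
    Integrable (fun x ↦ fderiv ℝ φ x (smearedField ρ η E N x)) ∧
    ∫ x, fderiv ℝ φ x (smearedField ρ η E N x) =
      coulombConst d * ((∑ q ∈ F, (N q : ℝ) * ∫ x, smearedCharge ρ η (x - q) * φ x) - ∫ x, φ x) := by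
  obtain ⟨-, hEloc, h, hh, hhE, hJ⟩ := hE
  have hμ := isRadialDensity_smearedCharge hρ hη
  set μ := smearedCharge ρ η
  have hae : (fun x ↦ fderiv ℝ φ x (smearedField ρ η E N x)) =ᵐ[volume] fun x ↦
      fderiv ℝ φ x (E x) + ∑ q ∈ F, (N q : ℝ) * fderiv ℝ φ x (radialField μ (x - q)) := by
    have hFnull : ∀ᵐ x : Space d, x ∉ F := by
      have := nontrivial_space hd
      exact (measure_eq_zero_iff_ae_notMem.1 (F.countable_toSet.measure_zero volume))
    filter_upwards [hFnull] with x hx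
    rcases le_or_gt ‖x‖ S with hxS | hxS
    · rw [smearedField_eq hd hρ hη E hF hxS hx]
      simp [map_add, map_sum, μ]
    · simp [IsTestFunction.fderiv_eq_zero hS hxS]
  have hi1 := hφ.integrable_fderiv_apply hEloc
  have hi2 : ∀ q ∈ F, Integrable fun x ↦ (N q : ℝ) * fderiv ℝ φ x (radialField μ (x - q)) :=
    fun q _ ↦ (hφ.integrable_fderiv_apply
      (((hμ.integrable_radialField hd).comp_sub_right q).locallyIntegrable)).const_mul _
  refine ⟨(hi1.add (integrable_finsetSum _ hi2)).congr hae.symm, ?_⟩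
  rw [integral_congr_ae hae, integral_add hi1 (integrable_finsetSum _ hi2),
    integral_finsetSum _ hi2, hhE.integral_fderiv_apply hh hEloc hφ, hJ φ hφ]
  simp only [integral_const_mul, hμ.integral_fderiv_radialField_sub hd hφ]
  rw [finsum_eq_sum_of_support_subset (s := F)]
  · simp only [one_mul, mul_sub, mul_left_comm _ (coulombConst d), Finset.sum_sub_distrib,
      ← Finset.mul_sum]
    ring
  · intro q hq
    have h1 : N q ≠ 0 := fun h0 ↦ hq (by simp [h0])
    have h2 : φ q ≠ 0 := fun h0 ↦ hq (by simp [h0])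
    have h3 := hS (subset_tsupport φ h2)
    simp at h3
    exact hF q h1 (by linarith)

/-! ### Mollification of radial densities. -/

/-- The convolution of the kernel `χ` with the density `μ`. -/
def mollify {d : ℕ} (χ μ : Space d → ℝ) (x : Space d) : ℝ := ∫ a, χ (x - a) * μ a

lemma exists_mollifier {d : ℕ} {ε : ℝ} (hε : 0 < ε) :
    ∃ χ : Space d → ℝ, IsTestFunction χ ∧ IsRadialDensity χ ε := by
  -- The squared norm is smooth at the origin, so this bump is both smooth and radial.
  obtain ⟨f, hf⟩ : ∃ f : Space d → ℝ, ∀ x, f x = Real.smoothTransition (1 - ‖x‖ ^ 2 / ε ^ 2) :=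
    ⟨_, fun _ ↦ rfl⟩
  have hf0 : ∀ x, 0 ≤ f x := fun x ↦ (hf x).symm ▸ Real.smoothTransition.nonneg _
  have hsupp : Function.support f ⊆ Metric.closedBall 0 ε := fun x hx ↦ by
    by_contra h
    refine hx ((hf x).trans (Real.smoothTransition.zero_of_nonpos ?_))
    have h1 : ε < ‖x‖ := by simpa using h
    rw [sub_nonpos, one_le_div (by positivity)]
    gcongr
  have hsmooth : ContDiff ℝ ((⊤ : ℕ∞) : WithTop ℕ∞) f := by
    rw [funext hf]
    exact Real.smoothTransition.contDiff.comp (contDiff_const.sub ((contDiff_norm_sq ℝ).div_const _))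
  have hcs : HasCompactSupport f := HasCompactSupport.intro (isCompact_closedBall 0 ε)
    fun x hx ↦ by
      by_contra h
      exact hx (hsupp h)
  have hint : Integrable f := hsmooth.continuous.integrable_of_hasCompactSupport hcs
  have hpos : 0 < ∫ x, f x := by
    refine hsmooth.continuous.integral_pos_of_hasCompactSupport_nonneg_nonzero hcs hf0 (x := 0) ?_
    simp [hf]
  refine ⟨fun x ↦ (∫ x, f x)⁻¹ * f x, ⟨contDiff_const.mul hsmooth, hcs.mul_left⟩, ?_, ?_, ?_, ?_, ?_⟩
  · intro x y h
    simp only [hf, h]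
  · intro x
    have := hf0 x
    positivity
  · exact (Function.support_mul_subset_right _ _).trans hsupp
  · exact hint.const_mul _
  · rw [integral_const_mul, inv_mul_cancel₀ hpos.ne']

lemma exists_linearIsometryEquiv_of_norm_eq {d : ℕ} {x y : Space d} (h : ‖x‖ = ‖y‖) :
    ∃ L : Space d ≃ₗᵢ[ℝ] Space d, L x = y :=
  ⟨_, Submodule.reflection_sub h⟩

namespace IsRadialDensity

variable {d : ℕ} {μ χ : Space d → ℝ} {R ε : ℝ}

lemma hasCompactSupport (hμ : IsRadialDensity μ R) : HasCompactSupport μ :=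
  HasCompactSupport.intro (isCompact_closedBall 0 R) fun x hx ↦ hμ.eq_zero (by simpa using hx)

lemma integrable_mollify_kernel (hμ : IsRadialDensity μ R) (hχ : IsTestFunction χ)
    (hχ' : IsRadialDensity χ ε) {K : Space d → ℝ} (hK : LocallyIntegrable K) :
    Integrable (fun z : Space d × Space d ↦ χ (z.1 - z.2) * μ z.2 * K z.1)
      (volume.prod volume) := by
  obtain ⟨C, hC⟩ := hχ.2.exists_bound_of_continuous hχ.continuous
  have h1 : Integrable ((Metric.closedBall 0 (R + ε)).indicator K) :=
    (integrable_indicator_iff Metric.isClosed_closedBall.measurableSet).2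
      (hK.integrableOn_isCompact (isCompact_closedBall _ _))
  have h2 := (h1.mul_prod hμ.integrable).bdd_mul (c := C)
    (f := fun z : Space d × Space d ↦ χ (z.1 - z.2))
    (hχ.continuous.comp (continuous_fst.sub continuous_snd)).aestronglyMeasurable
    (ae_of_all _ fun z ↦ hC _)
  refine h2.congr (ae_of_all _ fun z ↦ ?_)
  by_cases hz : z.1 ∈ Metric.closedBall (0 : Space d) (R + ε)
  · simp only [Set.indicator_of_mem hz]
    ring
  · have hz' : R + ε < ‖z.1‖ := by simpa using hz
    simp only [Set.indicator_of_notMem hz]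
    rcases lt_or_ge R ‖z.2‖ with h | h
    · simp [hμ.eq_zero h]
    · have : ε < ‖z.1 - z.2‖ := by
        have := norm_sub_norm_le z.1 z.2
        linarith
      simp [hχ'.eq_zero this]

lemma integral_mollify_mul (hμ : IsRadialDensity μ R) (hχ : IsTestFunction χ)
    (hχ' : IsRadialDensity χ ε) {K : Space d → ℝ} (hK : LocallyIntegrable K) :
    ∫ x, mollify χ μ x * K x = ∫ a, μ a * ∫ x, χ (x - a) * K x := by
  have h := integral_integral_swap (f := fun x a ↦ χ (x - a) * μ a * K x)
    (hμ.integrable_mollify_kernel hχ hχ' hK)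
  simp only [integral_mul_const] at h
  rw [show (∫ x, mollify χ μ x * K x) = ∫ x, (∫ a, χ (x - a) * μ a) * K x from rfl, h]
  congr 1
  ext a
  rw [← integral_const_mul]
  congr 1
  ext x
  ring

lemma integrable_mul_mollify (hμ : IsRadialDensity μ R) (hχ : IsTestFunction χ)
    (hχ' : IsRadialDensity χ ε) {K : Space d → ℝ} (hK : LocallyIntegrable K) :
    Integrable fun a ↦ μ a * ∫ x, χ (x - a) * K x := by
  refine (hμ.integrable_mollify_kernel hχ hχ' hK).integral_prod_right.congr (ae_of_all _ fun a ↦ ?_)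
  simp only
  rw [← integral_const_mul]
  congr 1
  ext x
  ring

lemma isTestFunction_mollify (hμ : IsRadialDensity μ R) (hχ : IsTestFunction χ) :
    IsTestFunction (mollify χ μ) := by
  have h : mollify χ μ = convolution μ χ (ContinuousLinearMap.lsmul ℝ ℝ) volume := by
    ext x
    simp [mollify, convolution, mul_comm]
  rw [h]
  exact ⟨hχ.2.contDiff_convolution_right _ hμ.integrable.locallyIntegrable hχ.1,
    hμ.hasCompactSupport.convolution _ hχ.2⟩

lemma mollify (hμ : IsRadialDensity μ R) (hχ : IsTestFunction χ) (hχ' : IsRadialDensity χ ε) :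
    IsRadialDensity (mollify χ μ) (R + ε) where
  radial x y h := by
    obtain ⟨L, rfl⟩ := exists_linearIsometryEquiv_of_norm_eq h
    unfold _root_.mollify
    rw [← L.measurePreserving.integral_comp L.toHomeomorph.measurableEmbedding
      fun a ↦ χ (L x - a) * μ a]
    congr 1
    ext a
    rw [← map_sub, hχ'.radial (L (x - a)) (x - a) (L.norm_map _), hμ.radial (L a) a (L.norm_map _)]
  nonneg x := integral_nonneg fun a ↦ mul_nonneg (hχ'.nonneg _) (hμ.nonneg _)
  support_subset x hx := by
    by_contra hz
    have hz' : R + ε < ‖x‖ := by simpa using hz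
    refine hx (integral_eq_zero_of_ae (ae_of_all _ fun a ↦ ?_))
    rcases lt_or_ge R ‖a‖ with h | h
    · simp [hμ.eq_zero h]
    · have : ε < ‖x - a‖ := by
        have := norm_sub_norm_le x a
        linarith
      simp [hχ'.eq_zero this]
  integrable := (hμ.isTestFunction_mollify hχ).continuous.integrable_of_hasCompactSupport
    (hμ.isTestFunction_mollify hχ).2
  integral_eq_one := by
    have h := hμ.integral_mollify_mul hχ hχ' (K := fun _ ↦ 1) (locallyIntegrable_const 1)
    simp only [mul_one] at h
    rw [h]
    have : ∀ a, ∫ x, χ (x - a) = 1 := fun a ↦ by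
      rw [integral_sub_right_eq_self χ a, hχ'.integral_eq_one]
    simp [this, hμ.integral_eq_one]

/-- If `K x ≥ L a` whenever `|x - a| ≤ ε`, then averaging `K` near `a` gives at least `L a`. -/
lemma integral_mul_le_integral_mollify_mul (hμ : IsRadialDensity μ R) (hχ : IsTestFunction χ)
    (hχ' : IsRadialDensity χ ε) {K L : Space d → ℝ} (hK : LocallyIntegrable K)
    (hL : Integrable fun a ↦ μ a * L a)
    (h : ∀ a, ∀ᵐ x, ‖x - a‖ ≤ ε → L a ≤ K x) :
    ∫ a, μ a * L a ≤ ∫ x, _root_.mollify χ μ x * K x := by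
  rw [hμ.integral_mollify_mul hχ hχ' hK]
  refine integral_mono hL (hμ.integrable_mul_mollify hχ hχ' hK) fun a ↦ ?_
  refine mul_le_mul_of_nonneg_left ?_ (hμ.nonneg a)
  have h1 : L a = ∫ x, χ (x - a) * L a := by
    rw [integral_mul_const, integral_sub_right_eq_self χ a, hχ'.integral_eq_one, one_mul]
  rw [h1]
  refine integral_mono_ae ((hχ'.integrable.comp_sub_right a).mul_const _) ?_ ?_
  · simpa [mul_comm] using (hχ.comp_sub_right a).integrable_mul hK
  · filter_upwards [h a] with x hx
    rcases lt_or_ge ε ‖x - a‖ with h2 | h2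
    · simp [hχ'.eq_zero h2]
    · exact mul_le_mul_of_nonneg_left (hx h2) (hχ'.nonneg _)

end IsRadialDensity

/-! ### Poisson's equation for smooth densities. -/

/-- The Coulomb potential `w * ψ` of a charge density `ψ`. -/
def coulombPotential {d : ℕ} (ψ : Space d → ℝ) (x : Space d) : ℝ := ∫ y, coulombKernel d (x - y) * ψ y

lemma IsTestFunction.contDiff_coulombPotential {d : ℕ} (hd : 2 ≤ d) {ψ : Space d → ℝ}
    (hψ : IsTestFunction ψ) :
    ContDiff ℝ ((⊤ : ℕ∞) : WithTop ℕ∞) (coulombPotential ψ) := by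
  have h : coulombPotential ψ =
      convolution (coulombKernel d) ψ (ContinuousLinearMap.lsmul ℝ ℝ) volume := by
    ext x
    simp only [coulombPotential, convolution, ContinuousLinearMap.lsmul_apply, smul_eq_mul]
    rw [← integral_sub_left_eq_self _ volume x]
    simp
  rw [h]
  exact hψ.2.contDiff_convolution_right _ (locallyIntegrable_coulombKernel hd) hψ.1

lemma integral_coulombPotential_mul_laplacian {d : ℕ} (hd : 2 ≤ d) {ψ φ : Space d → ℝ}
    (hψ : IsTestFunction ψ) (hφ : IsTestFunction φ) :
    ∫ x, coulombPotential ψ x * Laplacian.laplacian φ x = -coulombConst d * ∫ y, ψ y * φ y := by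
  have hΔ := hφ.laplacian
  obtain ⟨r, hr⟩ := hψ.2.isBounded.subset_closedBall (0 : Space d)
  obtain ⟨s, hs⟩ := hΔ.2.isBounded.subset_closedBall (0 : Space d)
  obtain ⟨C, hC⟩ := hΔ.2.exists_bound_of_continuous hΔ.continuous
  have h1 : Integrable ((Metric.closedBall 0 (r + s)).indicator (coulombKernel d)) :=
    (integrable_indicator_iff Metric.isClosed_closedBall.measurableSet).2
      ((locallyIntegrable_coulombKernel hd).integrableOn_isCompact (isCompact_closedBall _ _))
  have h2 := ((hψ.continuous.integrable_of_hasCompactSupport hψ.2).convolution_integrand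
    (ContinuousLinearMap.lsmul ℝ ℝ) h1 (μ := volume) (ν := volume)).mul_bdd (c := C)
    (g := fun z : Space d × Space d ↦ Laplacian.laplacian φ z.1)
    (hΔ.continuous.comp continuous_fst).aestronglyMeasurable (ae_of_all _ fun z ↦ hC _)
  have h3 : Integrable (fun z : Space d × Space d ↦
      coulombKernel d (z.1 - z.2) * ψ z.2 * Laplacian.laplacian φ z.1) (volume.prod volume) := by
    refine h2.congr (ae_of_all _ fun z ↦ ?_)
    by_cases hz1 : Laplacian.laplacian φ z.1 = 0
    · simp [hz1]
    by_cases hz2 : ψ z.2 = 0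
    · simp [hz2]
    have h4 := hs (subset_tsupport _ hz1)
    have h5 := hr (subset_tsupport _ hz2)
    rw [mem_closedBall_zero_iff] at h4 h5
    have h6 : z.1 - z.2 ∈ Metric.closedBall (0 : Space d) (r + s) := by
      rw [mem_closedBall_zero_iff]
      linarith [norm_sub_le z.1 z.2]
    simp only [Set.indicator_of_mem h6, ContinuousLinearMap.lsmul_apply, smul_eq_mul]
    ring
  have h := integral_integral_swap
    (f := fun x y ↦ coulombKernel d (x - y) * ψ y * Laplacian.laplacian φ x) h3
  simp only [integral_mul_const] at h
  rw [show (∫ x, coulombPotential ψ x * Laplacian.laplacian φ x) =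
    ∫ x, (∫ y, coulombKernel d (x - y) * ψ y) * Laplacian.laplacian φ x from rfl, h,
    ← integral_const_mul]
  congr 1
  ext y
  rw [mul_left_comm, ← integral_coulombKernel_mul_laplacian hd hφ y, ← integral_const_mul]
  congr 1
  ext x
  ring

lemma integral_fderiv_gradient_eq_neg {d : ℕ} {U φ : Space d → ℝ}
    (hU : ContDiff ℝ ((⊤ : ℕ∞) : WithTop ℕ∞) U) (hφ : IsTestFunction φ) :
    ∫ x, fderiv ℝ φ x (gradient U x) = -∫ x, U x * Laplacian.laplacian φ x := by
  have hU1 : ContDiff ℝ 1 U := hU.of_le (by exact_mod_cast le_top)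
  have hcU : ∀ i : Fin d, Continuous fun x ↦ fderiv ℝ U x (stdVec i) := fun i ↦
    (hU1.continuous_fderiv (by simp)).clm_apply continuous_const
  have hint : ∀ i : Fin d, Integrable fun x ↦ fderiv ℝ U x (stdVec i) * fderiv ℝ φ x (stdVec i) :=
    fun i ↦ (hφ.fderiv_apply _).integrable_mul (hcU i).locallyIntegrable
  have hint2 : ∀ i : Fin d, Integrable fun x ↦
      U x * fderiv ℝ (fun y ↦ fderiv ℝ φ y (stdVec i)) x (stdVec i) :=
    fun i ↦ ((hφ.fderiv_apply _).fderiv_apply _).integrable_mul hU.continuous.locallyIntegrable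
  simp_rw [fun x ↦ fderiv_apply_eq_sum φ x (gradient U x), gradient_apply]
  rw [hφ.laplacian_eq]
  simp only [Finset.mul_sum]
  rw [integral_finsetSum _ fun i _ ↦ hint i, integral_finsetSum _ fun i _ ↦ hint2 i,
    ← Finset.sum_neg_distrib]
  refine Finset.sum_congr rfl fun i _ ↦ ?_
  rw [integral_mul_fderiv_eq_neg_fderiv_mul_of_integrable (hint i) (hint2 i)
    ((hφ.fderiv_apply _).integrable_mul hU.continuous.locallyIntegrable)
    (fun x _ ↦ hU1.differentiable (by simp) x)
    (fun x _ ↦ ((hφ.fderiv_apply _).contDiff_nat 1).differentiable (by simp) x), neg_neg]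

/-- `-Δ (w * ψ) = c_d ψ`. -/
lemma integral_fderiv_gradient_coulombPotential {d : ℕ} (hd : 2 ≤ d) {ψ φ : Space d → ℝ}
    (hψ : IsTestFunction ψ) (hφ : IsTestFunction φ) :
    ∫ x, fderiv ℝ φ x (gradient (coulombPotential ψ) x) = coulombConst d * ∫ y, ψ y * φ y := by
  rw [integral_fderiv_gradient_eq_neg (hψ.contDiff_coulombPotential hd) hφ,
    integral_coulombPotential_mul_laplacian hd hψ hφ]
  ring

/-! ### The truncated potential. -/

/-- A smooth convex function which vanishes on `(-∞, 0]` and has slope `1` on `[1, ∞)`. -/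
def smoothRamp (t : ℝ) : ℝ := ∫ s in (0 : ℝ)..t, Real.smoothTransition s

lemma hasDerivAt_smoothRamp (t : ℝ) : HasDerivAt smoothRamp (Real.smoothTransition t) t :=
  intervalIntegral.integral_hasDerivAt_right
    (Real.smoothTransition.continuous.intervalIntegrable _ _)
    (Real.smoothTransition.continuous.stronglyMeasurableAtFilter _ _)
    Real.smoothTransition.continuous.continuousAt

lemma contDiff_smoothRamp : ContDiff ℝ ((⊤ : ℕ∞) : WithTop ℕ∞) smoothRamp := by
  rw [contDiff_infty_iff_deriv]
  refine ⟨fun t ↦ (hasDerivAt_smoothRamp t).differentiableAt, ?_⟩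
  rw [show deriv smoothRamp = Real.smoothTransition from
    funext fun t ↦ (hasDerivAt_smoothRamp t).deriv]
  exact Real.smoothTransition.contDiff

lemma smoothRamp_of_nonpos {t : ℝ} (ht : t ≤ 0) : smoothRamp t = 0 := by
  unfold smoothRamp
  rw [intervalIntegral.integral_congr (g := fun _ ↦ (0 : ℝ)), intervalIntegral.integral_zero]
  intro s hs
  rw [Set.uIcc_of_ge ht] at hs
  exact Real.smoothTransition.zero_of_nonpos hs.2

lemma monotone_smoothRamp : Monotone smoothRamp :=
  monotone_of_hasDerivAt_nonneg hasDerivAt_smoothRamp fun t ↦ Real.smoothTransition.nonneg t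

lemma smoothRamp_nonneg (t : ℝ) : 0 ≤ smoothRamp t := by
  rcases le_total t 0 with h | h
  · rw [smoothRamp_of_nonpos h]
  · rw [← smoothRamp_of_nonpos le_rfl]
    exact monotone_smoothRamp h

lemma smoothRamp_le {t : ℝ} (ht : 0 ≤ t) : smoothRamp t ≤ t := by
  have h : Monotone fun t ↦ t - smoothRamp t :=
    monotone_of_hasDerivAt_nonneg (fun t ↦ (hasDerivAt_id t).sub (hasDerivAt_smoothRamp t))
      fun t ↦ sub_nonneg.2 (Real.smoothTransition.le_one t)
  have := h ht
  simp only [smoothRamp_of_nonpos le_rfl, sub_zero] at this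
  linarith

lemma sub_one_le_smoothRamp (t : ℝ) : t - 1 ≤ smoothRamp t := by
  rcases le_total t 1 with h | h
  · linarith [smoothRamp_nonneg t]
  · have h1 := intervalIntegral.integral_add_adjacent_intervals (a := 0) (b := 1) (c := t)
      (Real.smoothTransition.continuous.intervalIntegrable _ _ : IntervalIntegrable _ volume _ _)
      (Real.smoothTransition.continuous.intervalIntegrable _ _)
    have h2 : ∫ s in (1 : ℝ)..t, Real.smoothTransition s = t - 1 := by
      rw [intervalIntegral.integral_congr (g := fun _ ↦ (1 : ℝ))]
      · simp
      · intro s hs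
        rw [Set.uIcc_of_le h] at hs
        exact Real.smoothTransition.one_of_one_le hs.1
    have h3 := smoothRamp_nonneg 1
    unfold smoothRamp at h3 ⊢
    linarith

/-- The truncated potential `(w * ψ - w(1))₊`, smoothened. -/
def cellFunction {d : ℕ} (ψ : Space d → ℝ) (x : Space d) : ℝ :=
  smoothRamp (coulombPotential ψ x - coulombProfile d 1)

lemma cellFunction_nonneg {d : ℕ} (ψ : Space d → ℝ) (x : Space d) : 0 ≤ cellFunction ψ x :=
  smoothRamp_nonneg _

lemma IsTestFunction.contDiff_cellFunction {d : ℕ} (hd : 2 ≤ d) {ψ : Space d → ℝ}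
    (hψ : IsTestFunction ψ) : ContDiff ℝ ((⊤ : ℕ∞) : WithTop ℕ∞) (cellFunction ψ) :=
  contDiff_smoothRamp.comp ((hψ.contDiff_coulombPotential hd).sub contDiff_const)

/-- The integral of `(w - w(1))₊`. -/
def kernelExcess (d : ℕ) : ℝ :=
  ∫ x in Metric.ball (0 : Space d) 1, (coulombKernel d x - coulombProfile d 1)

namespace IsRadialDensity

variable {d : ℕ} {ψ : Space d → ℝ} {R : ℝ}

/-- Outside the unit ball `w * ψ ≤ w ≤ w(1)`, however large the support of `ψ` is. -/
lemma cellFunction_eq_zero (hd : 2 ≤ d) (hψ : IsRadialDensity ψ R) {x : Space d} (hx : 1 ≤ ‖x‖) :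
    cellFunction ψ x = 0 := by
  refine smoothRamp_of_nonpos (sub_nonpos.2 ?_)
  have hx0 : x ≠ 0 := norm_pos_iff.1 (one_pos.trans_le hx)
  exact (hψ.potential_le hd hx0).trans (coulombProfile_anti one_pos hx)

lemma tsupport_cellFunction (hd : 2 ≤ d) (hψ : IsRadialDensity ψ R) :
    tsupport (cellFunction ψ) ⊆ Metric.closedBall 0 1 := by
  refine closure_minimal (fun x hx ↦ ?_) Metric.isClosed_closedBall
  by_contra h
  have h1 : 1 < ‖x‖ := by simpa using h
  exact hx (hψ.cellFunction_eq_zero hd h1.le)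

lemma isTestFunction_cellFunction (hd : 2 ≤ d) (hψ : IsRadialDensity ψ R)
    (hψ' : IsTestFunction ψ) : IsTestFunction (cellFunction ψ) :=
  ⟨hψ'.contDiff_cellFunction hd, (isCompact_closedBall (0 : Space d) 1).of_isClosed_subset
    (isClosed_tsupport _) (hψ.tsupport_cellFunction hd)⟩

/-- The ramp lies below the positive part and `w * ψ ≤ w`, so the bound depends on `d` alone. -/
lemma integral_cellFunction_le (hd : 2 ≤ d) (hψ : IsRadialDensity ψ R) (hψ' : IsTestFunction ψ) :
    ∫ x, cellFunction ψ x ≤ kernelExcess d := by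
  have hg := hψ.isTestFunction_cellFunction hd hψ'
  unfold kernelExcess
  rw [← integral_indicator Metric.isOpen_ball.measurableSet]
  refine integral_mono_ae (hg.continuous.integrable_of_hasCompactSupport hg.2) ?_ ?_
  · rw [integrable_indicator_iff Metric.isOpen_ball.measurableSet]
    exact (integrableOn_coulombKernel hd 1).sub (integrableOn_const measure_ball_lt_top.ne)
  · filter_upwards [ae_ne_zero hd] with x hx
    rcases lt_or_ge ‖x‖ 1 with h | h
    · rw [Set.indicator_of_mem (by simpa using h)]
      have h1 : coulombProfile d 1 ≤ coulombKernel d x :=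
        coulombProfile_anti (norm_pos_iff.2 hx) h.le
      have h2 : coulombPotential ψ x ≤ coulombKernel d x := hψ.potential_le hd hx
      calc _ ≤ smoothRamp (coulombKernel d x - coulombProfile d 1) :=
            monotone_smoothRamp (by linarith)
        _ ≤ _ := smoothRamp_le (by linarith)
    · rw [Set.indicator_of_notMem (by simpa using h), hψ.cellFunction_eq_zero hd h]

end IsRadialDensity

lemma IsTestFunction.mul {d : ℕ} {f φ : Space d → ℝ} (hφ : IsTestFunction φ)
    (hf : ContDiff ℝ ((⊤ : ℕ∞) : WithTop ℕ∞) f) : IsTestFunction fun x ↦ f x * φ x :=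
  ⟨hf.mul hφ.1, hφ.2.mul_left⟩

/-- The truncated potential satisfies `-Δ g ≤ c_d ψ`. -/
lemma integral_fderiv_gradient_cellFunction_le {d : ℕ} (hd : 2 ≤ d) {ψ φ : Space d → ℝ}
    (hψ : IsTestFunction ψ) (hψ0 : ∀ x, 0 ≤ ψ x) (hφ : IsTestFunction φ) (hφ0 : ∀ x, 0 ≤ φ x) :
    ∫ x, fderiv ℝ φ x (gradient (cellFunction ψ) x) ≤ coulombConst d * ∫ x, ψ x * φ x := by
  set U := coulombPotential ψ
  have hU := hψ.contDiff_coulombPotential hd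
  have hU1 : ContDiff ℝ 1 U := hU.of_le (by exact_mod_cast le_top)
  set c := coulombProfile d 1
  set θ : Space d → ℝ := fun x ↦ Real.smoothTransition (U x - c)
  have hθ : ContDiff ℝ ((⊤ : ℕ∞) : WithTop ℕ∞) θ :=
    Real.smoothTransition.contDiff.comp (hU.sub contDiff_const)
  have hdU : ∀ x, HasFDerivAt (fun y ↦ U y - c) (fderiv ℝ U x) x := fun x ↦
    ((hU1.differentiable (by simp) x).hasFDerivAt).sub_const c
  have hgrad : ∀ x, gradient (cellFunction ψ) x = θ x • gradient U x := fun x ↦ by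
    have h1 := (hasDerivAt_smoothRamp (U x - c)).comp_hasFDerivAt x (hdU x)
    have h2 : fderiv ℝ (cellFunction ψ) x = θ x • fderiv ℝ U x := h1.fderiv
    unfold gradient
    rw [h2, map_smul]
  have htest := hφ.mul hθ
  have hk : 0 ≤ coulombConst d := by
    rw [coulombConst_eq]
    exact mul_nonneg (coulombSlope_pos hd).le measureReal_nonneg
  have hi1 : Integrable fun x ↦ fderiv ℝ φ x (gradient (cellFunction ψ) x) :=
    hφ.integrable_fderiv_apply (continuous_gradient
      ((hψ.contDiff_cellFunction hd).of_le (by exact_mod_cast le_top))).locallyIntegrable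
  have hi2 : Integrable fun x ↦ fderiv ℝ (fun x ↦ θ x * φ x) x (gradient U x) :=
    htest.integrable_fderiv_apply (continuous_gradient hU1).locallyIntegrable
  -- With `θ` the slope of the ramp, `∇(θφ) · ∇U` exceeds `∇φ · θ∇U` by `φ` times the second
  -- derivative of the ramp times `|∇U|²`, which is nonnegative by convexity.
  calc _ ≤ ∫ x, fderiv ℝ (fun x ↦ θ x * φ x) x (gradient U x) := by
        refine integral_mono hi1 hi2 fun x ↦ ?_
        have h1 : HasFDerivAt θ (deriv Real.smoothTransition (U x - c) • fderiv ℝ U x) x :=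
          HasDerivAt.comp_hasFDerivAt (h₂ := Real.smoothTransition) x
            (((Real.smoothTransition.contDiff (n := 1)).differentiable (by simp)
              (U x - c)).hasDerivAt) (hdU x)
        have h2 := (h1.mul ((hφ.contDiff_nat 1).differentiable (by simp) x).hasFDerivAt).fderiv
        have h3 : fderiv ℝ (fun x ↦ θ x * φ x) x = θ x • fderiv ℝ φ x +
            φ x • deriv Real.smoothTransition (U x - c) • fderiv ℝ U x := h2
        simp only [hgrad, h3]
        simp only [add_apply, smul_apply, map_smul, smul_eq_mul]
        have h4 : 0 ≤ fderiv ℝ U x (gradient U x) := by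
          rw [← inner_gradient_left]
          exact real_inner_self_nonneg
        have h5 : 0 ≤ deriv Real.smoothTransition (U x - c) :=
          Real.smoothTransition.monotone.deriv_nonneg
        have := mul_nonneg (hφ0 x) (mul_nonneg h5 h4)
        linarith
    _ = coulombConst d * ∫ x, ψ x * (θ x * φ x) :=
        integral_fderiv_gradient_coulombPotential hd hψ htest
    _ ≤ _ := by
        refine mul_le_mul_of_nonneg_left (integral_mono
          (htest.integrable_mul hψ.continuous.locallyIntegrable)
          (hφ.integrable_mul hψ.continuous.locallyIntegrable) fun x ↦ ?_) hk
        refine mul_le_mul_of_nonneg_left ?_ (hψ0 x)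
        exact mul_le_of_le_one_left (hφ0 x) (Real.smoothTransition.le_one _)

/-! ### The self-energy under mollification and truncation. -/

lemma continuous_shifted_profile {d : ℕ} (hd : 2 ≤ d) {δ : ℝ} (hδ : 0 < δ) :
    Continuous fun z : Space d ↦ coulombProfile d (‖z‖ + δ) := by
  have h := (continuousOn_coulombProfile hd).comp (f := fun z : Space d ↦ ‖z‖ + δ)
    (s := Set.univ) (by fun_prop) (fun z _ ↦ by
      have := norm_nonneg z
      exact Set.mem_Ioi.2 (by linarith))
  exact continuousOn_univ.1 h

namespace IsRadialDensity

variable {d : ℕ} {μ : Space d → ℝ} {R : ℝ}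

lemma mono (hμ : IsRadialDensity μ R) {S : ℝ} (h : R ≤ S) : IsRadialDensity μ S :=
  ⟨hμ.radial, hμ.nonneg, hμ.support_subset.trans (Metric.closedBall_subset_closedBall h),
    hμ.integrable, hμ.integral_eq_one⟩

lemma integrable_shifted_interaction (hd : 2 ≤ d) (hμ : IsRadialDensity μ R) {δ : ℝ}
    (hδ : 0 < δ) :
    Integrable (fun z : Space d × Space d ↦ coulombProfile d (‖z.1 - z.2‖ + δ) * (μ z.1 * μ z.2))
      (volume.prod volume) := by
  have hc := continuous_shifted_profile hd hδ
  obtain ⟨C, hC⟩ := (isCompact_closedBall (0 : Space d) (R + R)).exists_bound_of_continuousOn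
    hc.continuousOn
  have h1 := hμ.integrable.mul_prod hμ.integrable
  refine (h1.norm.const_mul C).mono' ((hc.comp (continuous_fst.sub
    continuous_snd)).aestronglyMeasurable.mul h1.1) (ae_of_all _ fun z ↦ ?_)
  rcases lt_or_ge R ‖z.1‖ with h | h
  · simp [hμ.eq_zero h]
  rcases lt_or_ge R ‖z.2‖ with h' | h'
  · simp [hμ.eq_zero h']
  rw [norm_mul]
  refine mul_le_mul_of_nonneg_right (hC (z.1 - z.2) ?_) (norm_nonneg _)
  rw [mem_closedBall_zero_iff]
  linarith [norm_sub_le z.1 z.2]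

lemma integrable_mul_shifted_profile (hd : 2 ≤ d) (hμ : IsRadialDensity μ R) {δ : ℝ}
    (hδ : 0 < δ) (x : Space d) :
    Integrable fun b ↦ μ b * coulombProfile d (‖x - b‖ + δ) := by
  have hc : Continuous fun b ↦ coulombProfile d (‖x - b‖ + δ) :=
    (continuous_shifted_profile hd hδ).comp (f := fun b ↦ x - b) (by fun_prop)
  obtain ⟨C, hC⟩ := (isCompact_closedBall (0 : Space d) R).exists_bound_of_continuousOn
    hc.continuousOn
  refine (hμ.integrable.norm.mul_const C).mono' (hμ.integrable.1.mul hc.aestronglyMeasurable)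
    (ae_of_all _ fun b ↦ ?_)
  rcases lt_or_ge R ‖b‖ with h | h
  · simp [hμ.eq_zero h]
  · rw [norm_mul]
    exact mul_le_mul_of_nonneg_left (hC b (by simpa using h)) (norm_nonneg _)

lemma ae_prod_sub_ne_zero (hd : 2 ≤ d) :
    ∀ᵐ z : Space d × Space d ∂(volume.prod volume), z.1 - z.2 ≠ 0 :=
  (quasiMeasurePreserving_sub_of_right_invariant (volume : Measure (Space d)) volume).ae
    (ae_ne_zero hd)

/-- The shift by `δ` leaves room for displacing both charges slightly. As `δ → 0` the shifted
kernels are dominated by `w` and the kernel shifted by `1`, so some `δ` costs at most `1`. -/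
lemma exists_shifted_interaction_ge (hd : 2 ≤ d) (hμ : IsRadialDensity μ R)
    (hfin : Integrable fun z : Space d × Space d ↦
      coulombKernel d (z.1 - z.2) * (μ z.1 * μ z.2)) :
    ∃ δ : ℝ, 0 < δ ∧ δ ≤ 1 ∧ coulombInteraction d μ μ - 1 ≤
      ∫ a, μ a * ∫ b, μ b * coulombProfile d (‖a - b‖ + δ) := by
  have hlim : Tendsto (fun n : ℕ ↦ ∫ z : Space d × Space d,
      coulombProfile d (‖z.1 - z.2‖ + 1 / ((n : ℝ) + 1)) * (μ z.1 * μ z.2) ∂(volume.prod volume))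
      atTop (nhds (coulombInteraction d μ μ)) := by
    refine tendsto_integral_of_dominated_convergence
      (fun z ↦ |coulombKernel d (z.1 - z.2) * (μ z.1 * μ z.2)| +
        |coulombProfile d (‖z.1 - z.2‖ + 1) * (μ z.1 * μ z.2)|) (fun n ↦ ?_) ?_ (fun n ↦ ?_) ?_
    · exact (hμ.integrable_shifted_interaction hd (by positivity)).1
    · exact hfin.abs.add (hμ.integrable_shifted_interaction hd one_pos).abs
    · filter_upwards [ae_prod_sub_ne_zero hd] with z hz
      have hn := norm_pos_iff.2 hz
      rw [Real.norm_eq_abs, abs_mul _ (μ z.1 * μ z.2), abs_mul _ (μ z.1 * μ z.2),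
        abs_mul _ (μ z.1 * μ z.2), ← add_mul]
      refine mul_le_mul_of_nonneg_right ?_ (abs_nonneg _)
      have hδ : (0 : ℝ) < 1 / ((n : ℝ) + 1) := by positivity
      have hδ1 : 1 / ((n : ℝ) + 1) ≤ 1 := by
        rw [div_le_one (by positivity)]
        linarith [(Nat.cast_nonneg n : (0 : ℝ) ≤ n)]
      have h1 : coulombProfile d (‖z.1 - z.2‖ + 1 / ((n : ℝ) + 1)) ≤ coulombKernel d (z.1 - z.2) :=
        coulombProfile_anti hn (by linarith)
      have h2 : coulombProfile d (‖z.1 - z.2‖ + 1) ≤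
          coulombProfile d (‖z.1 - z.2‖ + 1 / ((n : ℝ) + 1)) :=
        coulombProfile_anti (by linarith) (by linarith)
      have h3 := le_abs_self (coulombKernel d (z.1 - z.2))
      have h4 := neg_abs_le (coulombProfile d (‖z.1 - z.2‖ + 1))
      have h5 := abs_nonneg (coulombKernel d (z.1 - z.2))
      have h6 := abs_nonneg (coulombProfile d (‖z.1 - z.2‖ + 1))
      rw [abs_le]
      constructor <;> linarith
    · filter_upwards [ae_prod_sub_ne_zero hd] with z hz
      refine Tendsto.mul_const _ ?_
      have h1 := (hasDerivAt_coulombProfile hd (norm_pos_iff.2 hz)).continuousAt.tendsto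
      refine h1.comp ?_
      simpa using (tendsto_one_div_add_atTop_nhds_zero_nat (𝕜 := ℝ)).const_add ‖z.1 - z.2‖
  obtain ⟨n, hn⟩ := (hlim.eventually_const_le (sub_one_lt _)).exists
  refine ⟨1 / ((n : ℝ) + 1), by positivity, ?_, hn.trans (le_of_eq ?_)⟩
  · rw [div_le_one (by positivity)]
    linarith [(Nat.cast_nonneg n : (0 : ℝ) ≤ n)]
  · rw [integral_prod _ (hμ.integrable_shifted_interaction hd (by positivity))]
    congr 1
    ext a
    rw [← integral_const_mul]
    congr 1
    ext b
    ring

/-- Mollifying moves each of the two charges by at most `ε`, and `w` is decreasing. -/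
lemma interaction_mollify_ge (hd : 2 ≤ d) (hμ : IsRadialDensity μ R) {χ : Space d → ℝ} {ε : ℝ}
    (hε : 0 < ε) (hχ : IsTestFunction χ) (hχ' : IsRadialDensity χ ε) :
    ∫ a, μ a * ∫ b, μ b * coulombProfile d (‖a - b‖ + (ε + ε)) ≤
      ∫ x, _root_.mollify χ μ x * coulombPotential (_root_.mollify χ μ) x := by
  have hU : ∀ x, ∫ b, μ b * coulombProfile d (‖x - b‖ + ε) ≤
      coulombPotential (_root_.mollify χ μ) x := fun x ↦ by
    have hloc : LocallyIntegrable fun y ↦ coulombKernel d (x - y) := by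
      rw [locallyIntegrable_iff]
      intro K hK
      obtain ⟨r, hr⟩ := hK.isBounded.subset_closedBall (0 : Space d)
      have h1 : Integrable ((Metric.ball (0 : Space d) (‖x‖ + r + 1)).indicator
          (coulombKernel d)) := (integrable_indicator_iff Metric.isOpen_ball.measurableSet).2
            (integrableOn_coulombKernel hd _)
      refine ((h1.comp_sub_left x).integrableOn (s := K)).congr_fun (fun y hy ↦ ?_)
        hK.measurableSet
      have h2 := hr hy
      rw [mem_closedBall_zero_iff] at h2
      refine Set.indicator_of_mem ?_ _
      rw [mem_ball_zero_iff]
      linarith [norm_sub_le x y]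
    have h := hμ.integral_mul_le_integral_mollify_mul hχ hχ' hloc
      (hμ.integrable_mul_shifted_profile hd hε x) fun a ↦ by
        have hne : ∀ᵐ y : Space d, y ≠ x := by
          have := nontrivial_space hd
          simp [ae_iff]
        filter_upwards [hne] with y hy hya
        refine coulombProfile_anti (norm_pos_iff.2 (sub_ne_zero.2 hy.symm)) ?_
        have := norm_sub_le_norm_sub_add_norm_sub x a y
        rw [norm_sub_rev a y] at this
        linarith
    simpa only [coulombPotential, mul_comm] using h
  have hint : Integrable fun a ↦ μ a * ∫ b, μ b * coulombProfile d (‖a - b‖ + (ε + ε)) := by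
    refine (hμ.integrable_shifted_interaction hd (add_pos hε hε)).integral_prod_left.congr
      (ae_of_all _ fun a ↦ ?_)
    simp only
    rw [← integral_const_mul]
    congr 1
    ext b
    ring
  refine hμ.integral_mul_le_integral_mollify_mul hχ hχ'
    ((hμ.isTestFunction_mollify hχ).contDiff_coulombPotential hd).continuous.locallyIntegrable
    hint fun a ↦ ae_of_all _ fun x hx ↦ le_trans ?_ (hU x)
  refine integral_mono (hμ.integrable_mul_shifted_profile hd (add_pos hε hε) a)
    (hμ.integrable_mul_shifted_profile hd hε x) fun b ↦ mul_le_mul_of_nonneg_left ?_ (hμ.nonneg b)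
  refine coulombProfile_anti (by have := norm_nonneg (x - b); linarith) ?_
  have := norm_sub_le_norm_sub_add_norm_sub x a b
  linarith

/-- The self-energy of `μ` is almost attained by testing against the truncated potential of a
mollification of `μ`. -/
lemma exists_mollifier_interaction_le (hd : 2 ≤ d) (hμ : IsRadialDensity μ R)
    (hfin : Integrable fun z : Space d × Space d ↦
      coulombKernel d (z.1 - z.2) * (μ z.1 * μ z.2)) :
    ∃ χ : Space d → ℝ, IsTestFunction χ ∧ IsRadialDensity χ 1 ∧
      coulombInteraction d μ μ - coulombProfile d 1 - 2 ≤
        ∫ x, _root_.mollify χ μ x * cellFunction (_root_.mollify χ μ) x := by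
  obtain ⟨δ, hδ, hδ1, hD⟩ := hμ.exists_shifted_interaction_ge hd hfin
  -- Each of the two charges may move by `δ / 2`, which uses up the shift `δ`.
  obtain ⟨χ, hχ, hχ'⟩ := exists_mollifier (d := d) (half_pos hδ)
  refine ⟨χ, hχ, hχ'.mono (by linarith), ?_⟩
  have h1 := hμ.interaction_mollify_ge hd (half_pos hδ) hχ hχ'
  rw [add_halves] at h1
  have hψ := hμ.mollify hχ hχ'
  have hψ' := hμ.isTestFunction_mollify hχ
  have hU := (hψ'.contDiff_coulombPotential hd).continuous
  have hi : ∀ f : Space d → ℝ, Continuous f →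
      Integrable fun x ↦ _root_.mollify χ μ x * f x := fun f hf ↦ by
    simpa [mul_comm] using hψ'.integrable_mul hf.locallyIntegrable
  -- Rounding the corner of the positive part costs another `1`, whence the total loss `2`.
  have h2 : ∫ x, _root_.mollify χ μ x * (coulombPotential (_root_.mollify χ μ) x -
      (coulombProfile d 1 + 1)) ≤
        ∫ x, _root_.mollify χ μ x * cellFunction (_root_.mollify χ μ) x := by
    refine integral_mono (hi _ (hU.sub continuous_const))
      (hi _ (hψ'.contDiff_cellFunction hd).continuous) fun x ↦ ?_
    refine mul_le_mul_of_nonneg_left ?_ (hψ.nonneg x)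
    have := sub_one_le_smoothRamp
      (coulombPotential (_root_.mollify χ μ) x - coulombProfile d 1)
    unfold cellFunction
    linarith
  simp only [mul_sub] at h2
  rw [integral_sub (hi _ hU) (hi _ continuous_const), integral_mul_const, hψ.integral_eq_one] at h2
  linarith

end IsRadialDensity

/-! ### Cubes, measurability and translated test functions. -/

lemma coulombConst_nonneg {d : ℕ} (hd : 2 ≤ d) : 0 ≤ coulombConst d := by
  rw [coulombConst_eq]
  exact mul_nonneg (coulombSlope_pos hd).le measureReal_nonneg

lemma isClosed_cube (d : ℕ) (R : ℝ) : IsClosed (cube d R) := by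
  have : cube d R = ⋂ i : Fin d, {x | |x i| ≤ R} := by
    ext x
    simp [cube]
  rw [this]
  exact isClosed_iInter fun i ↦ isClosed_le (by fun_prop) continuous_const

lemma exists_cube_subset_closedBall (d : ℕ) (R : ℝ) :
    ∃ S, 0 < S ∧ cube d R ⊆ Metric.closedBall 0 S := by
  refine ⟨√(∑ _i : Fin d, R ^ 2) + 1, by positivity, fun x hx ↦ ?_⟩
  rw [mem_closedBall_zero_iff, EuclideanSpace.norm_eq]
  refine (Real.sqrt_le_sqrt (Finset.sum_le_sum fun i _ ↦ ?_)).trans (le_add_of_nonneg_right one_pos.le)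
  rw [Real.norm_eq_abs]
  exact pow_le_pow_left₀ (abs_nonneg _) (hx i) 2

lemma IsAdmissibleField.exists_finset {d : ℕ} {m : ℝ} {E : Space d → Space d} {N : Space d → ℕ}
    (hE : IsAdmissibleField m E N) (S : ℝ) :
    ∃ F : Finset (Space d), ∀ q, N q ≠ 0 → ‖q‖ ≤ S → q ∈ F :=
  ⟨(hE.1 S).toFinset, fun q hq hqS ↦ by simpa using ⟨hq, hqS⟩⟩

lemma aestronglyMeasurable_smearedField {d : ℕ} (hd : 2 ≤ d) {ρ : Space d → ℝ}
    (hρ : IsSmearingProfile ρ) {η : ℝ} (hη : 0 < η) {E : Space d → Space d} {N : Space d → ℕ}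
    (hE : IsAdmissibleField 1 E N) (R : ℝ) :
    AEStronglyMeasurable (smearedField ρ η E N) (volume.restrict (cube d R)) := by
  obtain ⟨S, -, hS⟩ := exists_cube_subset_closedBall d R
  obtain ⟨F, hF⟩ := hE.exists_finset (S + η)
  have hμ := isRadialDensity_smearedCharge hρ hη
  have h1 : AEStronglyMeasurable (fun x ↦ E x + ∑ q ∈ F, (N q : ℝ) •
      radialField (smearedCharge ρ η) (x - q)) volume := by
    refine hE.2.1.aestronglyMeasurable.add ?_
    refine Measurable.aestronglyMeasurable ?_
    exact Finset.measurable_fun_sum _ fun q _ ↦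
      (hμ.measurable_radialField.comp (measurable_id.sub_const q)).const_smul (N q : ℝ)
  refine (h1.mono_measure Measure.restrict_le_self).congr ?_
  have hFnull : ∀ᵐ x : Space d, x ∉ F := by
    have := nontrivial_space hd
    exact (measure_eq_zero_iff_ae_notMem.1 (F.countable_toSet.measure_zero volume))
  filter_upwards [ae_restrict_of_ae hFnull, ae_restrict_mem (isClosed_cube d R).measurableSet]
    with x hxF hx
  have hxS : ‖x‖ ≤ S := by simpa using hS hx
  rw [smearedField_eq hd hρ hη E hF hxS hxF]

lemma lintegral_enorm_sq_eq {d : ℕ} {G : Space d → Space d} {s : Set (Space d)}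
    (hG : AEStronglyMeasurable G (volume.restrict s)) (hfin : ∫⁻ x in s, ‖G x‖ₑ ^ 2 ≠ ⊤) :
    IntegrableOn (fun x ↦ ‖G x‖ ^ 2) s ∧
      ∫ x in s, ‖G x‖ ^ 2 = (∫⁻ x in s, ‖G x‖ₑ ^ 2).toReal := by
  have h1 : ∀ x, ENNReal.ofReal (‖G x‖ ^ 2) = ‖G x‖ₑ ^ 2 := fun x ↦ by
    rw [ENNReal.ofReal_pow (norm_nonneg _), ofReal_norm]
  have h2 : AEStronglyMeasurable (fun x ↦ ‖G x‖ ^ 2) (volume.restrict s) := hG.norm.pow 2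
  constructor
  · refine ⟨h2, ?_⟩
    rw [hasFiniteIntegral_iff_ofReal (ae_of_all _ fun x ↦ by positivity)]
    simp only [h1]
    exact hfin.lt_top
  · rw [integral_eq_lintegral_of_nonneg_ae (ae_of_all _ fun x ↦ by positivity) h2]
    simp only [h1]

lemma gradient_finset_sum_sub {d : ℕ} {g : Space d → ℝ} (hg : IsTestFunction g)
    (F : Finset (Space d)) (N : Space d → ℕ) (x : Space d) :
    gradient (fun x ↦ ∑ p ∈ F, (N p : ℝ) * g (x - p)) x =
      ∑ p ∈ F, (N p : ℝ) • gradient g (x - p) := by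
  have h : fderiv ℝ (fun x ↦ ∑ p ∈ F, (N p : ℝ) * g (x - p)) x =
      ∑ p ∈ F, (N p : ℝ) • fderiv ℝ g (x - p) := by
    have hd : ∀ p, DifferentiableAt ℝ (fun x ↦ g (x - p)) x := fun p ↦
      ((hg.comp_sub_right p).contDiff_nat 1).differentiable (by simp) x
    rw [fderiv_fun_sum fun p _ ↦ (hd p).const_mul _]
    refine Finset.sum_congr rfl fun p _ ↦ ?_
    rw [fderiv_const_mul (hd p), fderiv_comp_sub]
  unfold gradient
  rw [h, map_sum]
  simp

lemma IsTestFunction.const_mul {d : ℕ} {φ : Space d → ℝ} (hφ : IsTestFunction φ) (c : ℝ) :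
    IsTestFunction fun x ↦ c * φ x := hφ.mul contDiff_const

lemma IsTestFunction.integrable {d : ℕ} {φ : Space d → ℝ} (hφ : IsTestFunction φ) :
    Integrable φ := hφ.continuous.integrable_of_hasCompactSupport hφ.2

lemma integral_fderiv_gradient_sub_le {d : ℕ} {g ψ φ : Space d → ℝ} {c : ℝ}
    (hcell : ∀ φ : Space d → ℝ, IsTestFunction φ → (∀ x, 0 ≤ φ x) →
      ∫ x, fderiv ℝ φ x (gradient g x) ≤ c * ∫ x, ψ x * φ x)
    (hφ : IsTestFunction φ) (hφ0 : ∀ x, 0 ≤ φ x) (p : Space d) :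
    ∫ x, fderiv ℝ φ x (gradient g (x - p)) ≤ c * ∫ x, ψ (x - p) * φ x := by
  have h := hcell _ (hφ.comp_add_right p) fun x ↦ hφ0 _
  simp only [fderiv_comp_add_right] at h
  rw [← integral_sub_right_eq_self (fun x ↦ fderiv ℝ φ (x + p) (gradient g x)) p,
    ← integral_sub_right_eq_self (fun x ↦ ψ x * φ (x + p)) p] at h
  simpa using h

/-- Averaging over translates of `φ` amounts to mollifying the charge, because `χ` is even. -/
lemma IsRadialDensity.integral_mollifier_mul_integral {d : ℕ} {μ χ : Space d → ℝ} {R ε : ℝ}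
    (hμ : IsRadialDensity μ R) (hχ : IsTestFunction χ) (hχ' : IsRadialDensity χ ε)
    {φ : Space d → ℝ} (hφ : IsTestFunction φ) (q : Space d) :
    Integrable (fun y ↦ χ y * ∫ x, μ (x - q) * φ (x - y)) ∧
    ∫ y, χ y * ∫ x, μ (x - q) * φ (x - y) = ∫ x, _root_.mollify χ μ (x - q) * φ x := by
  obtain ⟨C, hC⟩ := hφ.2.exists_bound_of_continuous hφ.continuous
  have hint : Integrable (fun z : Space d × Space d ↦ χ z.1 * μ z.2 * φ (z.2 + q - z.1))
      (volume.prod volume) :=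
    (hχ'.integrable.mul_prod hμ.integrable).mul_bdd
      (hφ.continuous.comp (by fun_prop)).aestronglyMeasurable (ae_of_all _ fun z ↦ hC _)
  have h1 : ∀ y, χ y * ∫ x, μ (x - q) * φ (x - y) =
      ∫ a, χ y * μ a * φ (a + q - y) := fun y ↦ by
    rw [← integral_add_right_eq_self _ q, ← integral_const_mul]
    congr 1
    ext a
    simp [mul_assoc]
  have h2 : ∫ x, _root_.mollify χ μ (x - q) * φ x = ∫ x, _root_.mollify χ μ x * φ (x + q) := by
    rw [← integral_add_right_eq_self _ q]
    simp
  simp only [h1]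
  refine ⟨hint.integral_prod_left, ?_⟩
  rw [integral_integral_swap (f := fun y a ↦ χ y * μ a * φ (a + q - y)) hint, h2,
    hμ.integral_mollify_mul hχ hχ' (hφ.comp_add_right q).continuous.locallyIntegrable]
  congr 1
  ext a
  rw [← integral_const_mul, ← integral_sub_left_eq_self _ volume a]
  congr 1
  ext x
  rw [hχ'.radial (a - x) (x - a) (norm_sub_rev _ _)]
  rw [show a + q - (a - x) = x + q by abel]
  ring

/-! ### Duality and the energy per charge. -/

lemma two_mul_fderiv_sub_le {d : ℕ} (φ : Space d → ℝ) (x v : Space d) :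
    2 * fderiv ℝ φ x v - fderiv ℝ φ x (gradient φ x) ≤ ‖v‖ ^ 2 := by
  rw [← inner_gradient_left, ← inner_gradient_left, real_inner_self_eq_norm_sq]
  have := norm_sub_sq_real (gradient φ x) v
  nlinarith [sq_nonneg ‖gradient φ x - v‖]

/-- Duality: the energy in a cube is bounded below by testing against a gradient field. -/
lemma test_le_energy {d : ℕ} (hd : 2 ≤ d) {ρ : Space d → ℝ}
    (hρ : IsSmearingProfile ρ) {η : ℝ} (hη : 0 < η) {E : Space d → Space d} {N : Space d → ℕ}
    (hE : IsAdmissibleField 1 E N) {R : ℝ} (P : Finset (Space d))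
    (hfin : ∫⁻ x in cube d R, ‖smearedField ρ η E N x‖ₑ ^ 2 ≠ ⊤)
    {φ : Space d → ℝ} (hφ : IsTestFunction φ) (hφ0 : ∀ x, 0 ≤ φ x) (hsupp : tsupport φ ⊆ cube d R) :
    2 * (coulombConst d * ((∑ q ∈ P, (N q : ℝ) * ∫ x, smearedCharge ρ η (x - q) * φ x) -
      ∫ x, φ x)) - ∫ x, fderiv ℝ φ x (gradient φ x) ≤
      (∫⁻ x in cube d R, ‖smearedField ρ η E N x‖ₑ ^ 2).toReal := by
  classical
  obtain ⟨S, -, hS⟩ := exists_cube_subset_closedBall d R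
  obtain ⟨F₀, hF₀⟩ := hE.exists_finset (S + η)
  -- The divergence equation needs every charge acting in the cube. The charges outside `P`
  -- contribute nonnegatively and are dropped.
  set F := F₀ ∪ P
  have hμ := isRadialDensity_smearedCharge hρ hη
  obtain ⟨hi1, h1⟩ := integral_fderiv_smearedField hd hρ hη hE (F := F)
    (fun q hq hqS ↦ Finset.mem_union_left _ (hF₀ q hq hqS)) hφ (hsupp.trans hS)
  obtain ⟨hi2, h2⟩ := lintegral_enorm_sq_eq (aestronglyMeasurable_smearedField hd hρ hη hE R) hfin
  have hi3 : Integrable fun x ↦ fderiv ℝ φ x (gradient φ x) :=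
    hφ.integrable_fderiv_apply (continuous_gradient (hφ.contDiff_nat 1)).locallyIntegrable
  have hsum : ∑ q ∈ P, (N q : ℝ) * ∫ x, smearedCharge ρ η (x - q) * φ x ≤
      ∑ q ∈ F, (N q : ℝ) * ∫ x, smearedCharge ρ η (x - q) * φ x :=
    Finset.sum_le_sum_of_subset_of_nonneg Finset.subset_union_right fun q _ _ ↦
      mul_nonneg (Nat.cast_nonneg _)
        (integral_nonneg fun x ↦ mul_nonneg (hμ.nonneg _) (hφ0 x))
  have hzero : ∀ x, x ∉ cube d R → fderiv ℝ φ x = 0 := fun x hx ↦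
    image_eq_zero_of_notMem_tsupport fun h ↦ hx (hsupp (tsupport_fderiv_subset ℝ h))
  rw [← h2]
  calc _ ≤ 2 * (∫ x, fderiv ℝ φ x (smearedField ρ η E N x)) -
        ∫ x, fderiv ℝ φ x (gradient φ x) := by
        rw [h1]
        have := mul_le_mul_of_nonneg_left hsum (coulombConst_nonneg hd)
        rw [mul_sub, mul_sub]
        linarith
    _ = ∫ x, (2 * fderiv ℝ φ x (smearedField ρ η E N x) - fderiv ℝ φ x (gradient φ x)) := by
        rw [integral_sub (hi1.const_mul 2) hi3, integral_const_mul]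
    _ = ∫ x in cube d R,
        (2 * fderiv ℝ φ x (smearedField ρ η E N x) - fderiv ℝ φ x (gradient φ x)) := by
        rw [setIntegral_eq_integral_of_forall_compl_eq_zero]
        intro x hx
        simp [hzero x hx]
    _ ≤ _ := integral_mono ((hi1.const_mul 2).sub hi3).integrableOn hi2 fun x ↦
        two_mul_fderiv_sub_le φ x _

/-- The margin `2` is the unit radius of the support of `g` plus a translation of length at most
`1`. -/
lemma tsupport_finset_sum_sub_subset {d : ℕ} {g : Space d → ℝ}
    (hg : tsupport g ⊆ Metric.closedBall 0 1) (P : Finset (Space d)) (N : Space d → ℕ) {R : ℝ}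
    (hP : ∀ p ∈ P, Metric.closedBall p 2 ⊆ cube d R) {y : Space d} (hy : ‖y‖ ≤ 1) :
    tsupport (fun x ↦ ∑ p ∈ P, (N p : ℝ) * g (x - y - p)) ⊆ cube d R := by
  refine closure_minimal (fun x hx ↦ ?_) (isClosed_cube d R)
  obtain ⟨p, hp, hne⟩ := Finset.exists_ne_zero_of_sum_ne_zero hx
  refine hP p hp ?_
  have h1 := hg (subset_tsupport g (right_ne_zero_of_mul hne))
  rw [mem_closedBall_zero_iff] at h1
  rw [mem_closedBall_iff_norm]
  calc ‖x - p‖ = ‖(x - y - p) + y‖ := by congr 1; abel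
    _ ≤ 2 := (norm_add_le _ _).trans (by linarith)

/-- Every charge well inside a cube contributes its self-energy, up to a constant. -/
lemma charge_mul_le_energy {d : ℕ} (hd : 2 ≤ d) {ρ : Space d → ℝ}
    (hρ : IsSmearingProfile ρ) {η : ℝ} (hη : 0 < η) {E : Space d → Space d} {N : Space d → ℕ}
    (hE : IsAdmissibleField 1 E N) {R : ℝ} (P : Finset (Space d))
    (hP : ∀ p ∈ P, Metric.closedBall p 2 ⊆ cube d R)
    (hfin : ∫⁻ x in cube d R, ‖smearedField ρ η E N x‖ₑ ^ 2 ≠ ⊤)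
    {χ g : Space d → ℝ} (hχ : IsTestFunction χ) (hχ' : IsRadialDensity χ 1)
    (hg : IsTestFunction g) (hg0 : ∀ x, 0 ≤ g x) (hgsupp : tsupport g ⊆ Metric.closedBall 0 1)
    (hcell : ∀ φ : Space d → ℝ, IsTestFunction φ → (∀ x, 0 ≤ φ x) →
      ∫ x, fderiv ℝ φ x (gradient g x) ≤
        coulombConst d * ∫ x, mollify χ (smearedCharge ρ η) x * φ x) :
    (∑ p ∈ P, (N p : ℝ)) * (coulombConst d *
      ((∫ x, mollify χ (smearedCharge ρ η) x * g x) - 2 * ∫ x, g x)) ≤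
      (∫⁻ x in cube d R, ‖smearedField ρ η E N x‖ₑ ^ 2).toReal := by
  have hμ := isRadialDensity_smearedCharge hρ hη
  set μ := smearedCharge ρ η
  set A := (∫⁻ x in cube d R, ‖smearedField ρ η E N x‖ₑ ^ 2).toReal
  set c := coulombConst d
  have hc : 0 ≤ c := coulombConst_nonneg hd
  have hψ := hμ.mollify hχ hχ'
  have hψ' := hμ.isTestFunction_mollify hχ
  set ψ := mollify χ μ
  set H : Space d → ℝ := fun x ↦ ∑ p ∈ P, (N p : ℝ) * g (x - p)
  have hterm : ∀ p ∈ P, IsTestFunction fun x ↦ (N p : ℝ) * g (x - p) := fun p _ ↦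
    (hg.comp_sub_right p).const_mul _
  have hH : IsTestFunction H := IsTestFunction.finset_sum P hterm
  have hH0 : ∀ x, 0 ≤ H x := fun x ↦
    Finset.sum_nonneg fun p _ ↦ mul_nonneg (Nat.cast_nonneg _) (hg0 _)
  have hHint : ∫ x, H x = (∑ p ∈ P, (N p : ℝ)) * ∫ x, g x := by
    rw [integral_finsetSum P fun p hp ↦ (hterm p hp).integrable, Finset.sum_mul]
    refine Finset.sum_congr rfl fun p _ ↦ ?_
    rw [integral_const_mul, integral_sub_right_eq_self g p]
  -- One of the two gradients is expanded as a sum of cells; `H` itself is the nonnegative test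
  -- function in `-Δg ≤ c_d ψ`.
  have hHgrad : ∫ x, fderiv ℝ H x (gradient H x) ≤
      c * ∑ p ∈ P, (N p : ℝ) * ∫ x, ψ (x - p) * H x := by
    have h1 : ∀ x, fderiv ℝ H x (gradient H x) =
        ∑ p ∈ P, (N p : ℝ) * fderiv ℝ H x (gradient g (x - p)) := fun x ↦ by
      rw [show gradient H x = _ from gradient_finset_sum_sub hg P N x]
      simp
    simp only [h1]
    have hcg : ∀ p, Continuous fun x ↦ gradient g (x - p) := fun p ↦
      (continuous_gradient (hg.contDiff_nat 1)).comp (by fun_prop)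
    rw [integral_finsetSum P fun p _ ↦
      (hH.integrable_fderiv_apply (hcg p).locallyIntegrable).const_mul _, Finset.mul_sum]
    refine Finset.sum_le_sum fun p _ ↦ ?_
    rw [integral_const_mul, mul_left_comm]
    exact mul_le_mul_of_nonneg_left (integral_fderiv_gradient_sub_le hcell hH hH0 p)
      (Nat.cast_nonneg _)
  have hshift : ∀ y : Space d, ‖y‖ ≤ 1 →
      2 * (c * ((∑ q ∈ P, (N q : ℝ) * ∫ x, μ (x - q) * H (x - y)) - ∫ x, H x)) -
        ∫ x, fderiv ℝ H x (gradient H x) ≤ A := fun y hy ↦ by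
    have h := test_le_energy hd hρ hη hE P hfin (hH.comp_sub_right y) (fun x ↦ hH0 _)
      (tsupport_finset_sum_sub_subset hgsupp P N hP hy)
    have h1 : ∀ x, fderiv ℝ (fun x ↦ H (x - y)) x (gradient (fun x ↦ H (x - y)) x) =
        fderiv ℝ H (x - y) (gradient H (x - y)) := fun x ↦ by
      unfold gradient
      rw [fderiv_comp_sub]
    simp only [h1] at h
    rwa [integral_sub_right_eq_self (fun x ↦ fderiv ℝ H x (gradient H x)) y,
      integral_sub_right_eq_self H y] at h
  set B := 2 * (c * ∫ x, H x) + ∫ x, fderiv ℝ H x (gradient H x)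
  -- The bounds for the translates `H(· - y)` are averaged with weight `χ y`, which turns `μ` into
  -- `ψ`; the other terms do not depend on `y`.
  have hav : 2 * c * (∑ q ∈ P, (N q : ℝ) * ∫ x, ψ (x - q) * H x) ≤ A + B := by
    have hm := fun q ↦ hμ.integral_mollifier_mul_integral hχ hχ' hH q
    calc _ = ∫ y, 2 * c * ∑ q ∈ P, (N q : ℝ) * (χ y * ∫ x, μ (x - q) * H (x - y)) := by
          rw [integral_const_mul, integral_finsetSum P fun q _ ↦ (hm q).1.const_mul _]
          simp only [integral_const_mul, (hm _).2]
          rfl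
      _ ≤ ∫ y, χ y * (A + B) := by
          refine integral_mono ((integrable_finsetSum P fun q _ ↦
            (hm q).1.const_mul _).const_mul _) (hχ'.integrable.mul_const _) fun y ↦ ?_
          rcases lt_or_ge 1 ‖y‖ with hy | hy
          · simp [hχ'.eq_zero hy]
          · have h1 := mul_le_mul_of_nonneg_left (hshift y hy) (hχ'.nonneg y)
            have h2 : ∑ q ∈ P, (N q : ℝ) * (χ y * ∫ x, μ (x - q) * H (x - y)) =
                χ y * ∑ q ∈ P, (N q : ℝ) * ∫ x, μ (x - q) * H (x - y) := by
              rw [Finset.mul_sum]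
              exact Finset.sum_congr rfl fun q _ ↦ mul_left_comm _ _ _
            simp only [h2, B]
            linarith
      _ = A + B := by rw [integral_mul_const, hχ'.integral_eq_one, one_mul]
  -- Only the self-interactions are kept. Integrality of the multiplicities enters here, through
  -- `N_q² ≥ N_q`.
  have hdiag : (∑ p ∈ P, (N p : ℝ)) * ∫ x, ψ x * g x ≤
      ∑ q ∈ P, (N q : ℝ) * ∫ x, ψ (x - q) * H x := by
    rw [Finset.sum_mul]
    refine Finset.sum_le_sum fun q hq ↦ ?_
    rcases Nat.eq_zero_or_pos (N q) with h0 | h0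
    · simp [h0]
    refine mul_le_mul_of_nonneg_left ?_ (Nat.cast_nonneg _)
    rw [← integral_sub_right_eq_self (fun x ↦ ψ x * g x) q]
    have hcψ : Continuous fun x ↦ ψ (x - q) := (hψ'.comp_sub_right q).continuous
    refine integral_mono ((hg.comp_sub_right q).integrable_mul hcψ.locallyIntegrable)
      (hH.integrable_mul hcψ.locallyIntegrable) fun x ↦ ?_
    refine mul_le_mul_of_nonneg_left ?_ (hψ.nonneg _)
    calc g (x - q) ≤ (N q : ℝ) * g (x - q) :=
          le_mul_of_one_le_left (hg0 _) (by exact_mod_cast h0)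
      _ ≤ H x := Finset.single_le_sum (f := fun p ↦ (N p : ℝ) * g (x - p))
          (fun p _ ↦ mul_nonneg (Nat.cast_nonneg _) (hg0 _)) hq
  have h1 := mul_le_mul_of_nonneg_left hdiag hc
  simp only [B, hHint] at hav
  linarith

/-! ### Scaling of the self-energy. -/

lemma smearedCharge_one {d : ℕ} (ρ : Space d → ℝ) : smearedCharge ρ 1 = ρ := by
  ext x
  simp [smearedCharge]

lemma coulombKernel_smul {d : ℕ} {η : ℝ} (hη : 0 < η) {u : Space d} (hu : u ≠ 0) :
    coulombKernel d (η • u) = (if d = 2 then 1 else coulombProfile d η) * coulombKernel d u +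
      (if d = 2 then coulombProfile d η else 0) := by
  have hn := norm_pos_iff.2 hu
  unfold coulombKernel coulombProfile
  rw [norm_smul, Real.norm_of_nonneg hη.le]
  split_ifs with h
  · rw [Real.log_mul hη.ne' hn.ne']
    ring
  · rw [mul_pow]
    field_simp
    ring

/-- Scaling multiplies `w` by `w(η)` for `d ≥ 3` and adds `w(η)` for `d = 2`; since `ρ` has mass
one, the additive term passes unchanged to the self-energy. -/
lemma interaction_smearedCharge {d : ℕ} (hd : 2 ≤ d) {ρ : Space d → ℝ}
    (hρ : IsSmearingProfile ρ) {η : ℝ} (hη : 0 < η) :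
    Integrable (fun z : Space d × Space d ↦ coulombKernel d (z.1 - z.2) *
      (smearedCharge ρ η z.1 * smearedCharge ρ η z.2)) ∧
    coulombInteraction d (smearedCharge ρ η) (smearedCharge ρ η) =
      (if d = 2 then 1 else coulombProfile d η) * coulombInteraction d ρ ρ +
      (if d = 2 then coulombProfile d η else 0) := by
  set a : ℝ := if d = 2 then 1 else coulombProfile d η
  set b : ℝ := if d = 2 then coulombProfile d η else 0
  set G : Space d × Space d → ℝ := fun z ↦
    a * (coulombKernel d (z.1 - z.2) * (ρ z.1 * ρ z.2)) + b * (ρ z.1 * ρ z.2)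
  have hi1 : Integrable fun z : Space d × Space d ↦ ρ z.1 * ρ z.2 :=
    hρ.integrable.mul_prod hρ.integrable
  have hG : Integrable G := (hρ.finite_self_energy.const_mul a).add (hi1.const_mul b)
  have hGint : ∫ z, G z = a * coulombInteraction d ρ ρ + b := by
    rw [integral_add (hρ.finite_self_energy.const_mul a) (hi1.const_mul b), integral_const_mul,
      integral_const_mul]
    have : ∫ z : Space d × Space d, ρ z.1 * ρ z.2 = 1 := by
      rw [Measure.volume_eq_prod, integral_prod_mul, hρ.integral_eq_one, one_mul]
    rw [this, mul_one]
    rfl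
  have hae : (fun z : Space d × Space d ↦ coulombKernel d (z.1 - z.2) *
      (smearedCharge ρ η z.1 * smearedCharge ρ η z.2)) =ᵐ[volume]
      fun z ↦ ((η ^ d)⁻¹ * (η ^ d)⁻¹) * G (η⁻¹ • z) := by
    filter_upwards [IsRadialDensity.ae_prod_sub_ne_zero hd] with z hz
    have h1 : η⁻¹ • (z.1 - z.2) ≠ 0 := smul_ne_zero (inv_ne_zero hη.ne') hz
    have h2 := coulombKernel_smul hη h1
    rw [smul_smul, mul_inv_cancel₀ hη.ne', one_smul] at h2
    simp only [G, smearedCharge, h2, Prod.smul_fst, Prod.smul_snd, ← smul_sub]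
    ring
  have : (volume : Measure (Space d × Space d)).IsAddHaarMeasure := by
    rw [Measure.volume_eq_prod]
    infer_instance
  constructor
  · exact ((hG.comp_smul (inv_ne_zero hη.ne')).const_mul _).congr hae.symm
  · refine (integral_congr_ae hae).trans ?_
    rw [integral_const_mul,
      Measure.integral_comp_inv_smul_of_nonneg _ _ hη.le, hGint]
    simp only [Module.finrank_prod, finrank_euclideanSpace_fin, smul_eq_mul, pow_add]
    have : η ^ d ≠ 0 := (pow_pos hη d).ne'
    field_simp

lemma coulombConst_mul_interaction {d : ℕ} (hd : 2 ≤ d) {ρ : Space d → ℝ}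
    (hρ : IsSmearingProfile ρ) {η : ℝ} (hη : 0 < η) :
    coulombConst d * coulombInteraction d (smearedCharge ρ η) (smearedCharge ρ η) =
      kappa ρ * coulombProfile d η + gammaTwo ρ := by
  rw [(interaction_smearedCharge hd hρ hη).2]
  unfold kappa gammaTwo
  rw [smearedCharge_one]
  split_ifs <;> ring

lemma coulombConst_pos {d : ℕ} (hd : 2 ≤ d) : 0 < coulombConst d := by
  have := nontrivial_space hd
  rw [coulombConst_eq]
  refine mul_pos (coulombSlope_pos hd) ?_
  rw [measureReal_def, ENNReal.toReal_pos_iff]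
  exact ⟨Measure.measure_univ_pos.2 (Measure.toSphere_ne_zero _), measure_lt_top _ _⟩

/-! ### Counting the charges in a cube. -/

lemma volume_cube (d : ℕ) {R : ℝ} (hR : 0 ≤ R) :
    volume (cube d R) = ENNReal.ofReal ((2 * R) ^ d) := by
  have h1 : cube d R = (WithLp.ofLp : Space d → Fin d → ℝ) ⁻¹'
      (Set.univ.pi fun _ ↦ Set.Icc (-R) R) := by
    ext x
    simp only [cube, abs_le, Set.mem_preimage, Set.mem_univ_pi, Set.mem_Icc, Set.mem_ofPred_eq]
  rw [h1, (PiLp.volume_preserving_ofLp (Fin d)).measure_preimage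
    (MeasurableSet.univ_pi fun _ ↦ measurableSet_Icc).nullMeasurableSet, volume_pi_pi]
  simp only [Real.volume_Icc, Finset.prod_const, Finset.card_univ, Fintype.card_fin]
  rw [← ENNReal.ofReal_pow (by linarith)]
  congr 2
  ring

lemma isCompact_cube (d : ℕ) (R : ℝ) : IsCompact (cube d R) := by
  obtain ⟨S, -, hS⟩ := exists_cube_subset_closedBall d R
  exact (isCompact_closedBall _ _).of_isClosed_subset (isClosed_cube d R) hS

lemma exists_cube_cutoff (d : ℕ) {a b : ℝ} (ha : 0 < a) (hab : a < b) :
    ∃ φ : Space d → ℝ, IsTestFunction φ ∧ (∀ x, 0 ≤ φ x) ∧ (∀ x, φ x ≤ 1) ∧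
      tsupport φ ⊆ cube d b ∧ (2 * a) ^ d ≤ ∫ x, φ x := by
  let f : ContDiffBump (0 : ℝ) := ⟨a, b, ha, hab⟩
  have hsmooth : ContDiff ℝ ((⊤ : ℕ∞) : WithTop ℕ∞) fun x : Space d ↦ ∏ i, f (x i) :=
    contDiff_prod fun i _ ↦ f.contDiff.comp (by fun_prop)
  have hsupp : tsupport (fun x : Space d ↦ ∏ i, f (x i)) ⊆ cube d b := by
    refine closure_minimal (fun x hx i ↦ ?_) (isClosed_cube d b)
    have h1 := Finset.prod_ne_zero_iff.1 hx i (Finset.mem_univ i)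
    have h2 : x i ∈ Function.support f := h1
    rw [f.support_eq] at h2
    have h3 : |x i| < b := by simpa using h2
    exact h3.le
  have htest : IsTestFunction fun x : Space d ↦ ∏ i, f (x i) :=
    ⟨hsmooth, (isCompact_cube d b).of_isClosed_subset (isClosed_tsupport _) hsupp⟩
  have h0 : ∀ x : Space d, 0 ≤ ∏ i, f (x i) := fun x ↦ Finset.prod_nonneg fun i _ ↦ f.nonneg
  refine ⟨_, htest, h0, fun x ↦ Finset.prod_le_one (fun i _ ↦ f.nonneg) fun i _ ↦ f.le_one,
    hsupp, ?_⟩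
  have h1 : ∫ x in cube d a, (1 : ℝ) = (2 * a) ^ d := by
    rw [setIntegral_const, measureReal_def, volume_cube d ha.le, ENNReal.toReal_ofReal
      (by positivity)]
    simp
  rw [← h1, ← integral_indicator (isClosed_cube d a).measurableSet]
  refine integral_mono ((integrable_indicator_iff (isClosed_cube d a).measurableSet).2
    (integrableOn_const (isCompact_cube d a).measure_lt_top.ne)) htest.integrable fun x ↦ ?_
  by_cases hx : x ∈ cube d a
  · rw [Set.indicator_of_mem hx]
    refine le_of_eq (Finset.prod_eq_one fun i _ ↦ ?_).symm
    exact f.one_of_mem_closedBall (by simpa using hx i)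
  · rw [Set.indicator_of_notMem hx]
    exact h0 x

/-- If the energy in a cube is controlled, then the number of charges well inside the cube is
bounded below. -/
lemma charge_number_ge {d : ℕ} (hd : 2 ≤ d) {ρ : Space d → ℝ}
    (hρ : IsSmearingProfile ρ) {η : ℝ} (hη : 0 < η) {E : Space d → Space d} {N : Space d → ℕ}
    (hE : IsAdmissibleField 1 E N) {φ : Space d → ℝ} (hφ : IsTestFunction φ)
    (hφ0 : ∀ x, 0 ≤ φ x) (hφ1 : ∀ x, φ x ≤ 1) {b : ℝ} (hsupp : tsupport φ ⊆ cube d b)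
    {M : ℝ} (hM : ∀ x, ‖fderiv ℝ φ x‖ ≤ M) {R : ℝ} (hR : 0 < R) (hbR : R * b + η + 2 ≤ R)
    (hfin : ∫⁻ x in cube d R, ‖smearedField ρ η E N x‖ₑ ^ 2 ≠ ⊤) :
    ∃ P : Finset (Space d), (∀ p ∈ P, Metric.closedBall p 2 ⊆ cube d R) ∧
      R ^ d * (∫ x, φ x) - M / (coulombConst d * R) *
        ((2 * R) ^ d + (∫⁻ x in cube d R, ‖smearedField ρ η E N x‖ₑ ^ 2).toReal) ≤
        ∑ p ∈ P, (N p : ℝ) := by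
  classical
  have hμ := isRadialDensity_smearedCharge hρ hη
  set μ := smearedCharge ρ η
  have hc := coulombConst_pos hd
  have hM0 : 0 ≤ M := (norm_nonneg _).trans (hM 0)
  have hφR : IsTestFunction fun x ↦ φ (R⁻¹ • x) :=
    ⟨hφ.1.comp (contDiff_const_smul _), hφ.2.comp_smul (inv_ne_zero hR.ne')⟩
  have hsuppR : tsupport (fun x ↦ φ (R⁻¹ • x)) ⊆ cube d (R * b) := by
    refine closure_minimal (fun x hx i ↦ ?_) (isClosed_cube d _)
    have h1 := hsupp (subset_tsupport φ hx) i
    simp only [PiLp.smul_apply, smul_eq_mul, abs_mul, abs_of_pos (inv_pos.2 hR)] at h1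
    rwa [inv_mul_le_iff₀ hR] at h1
  have hsuppR' : tsupport (fun x ↦ φ (R⁻¹ • x)) ⊆ cube d R :=
    hsuppR.trans fun x hx i ↦ (hx i).trans (by linarith)
  obtain ⟨S, -, hS⟩ := exists_cube_subset_closedBall d R
  obtain ⟨F, hF⟩ := hE.exists_finset (S + η)
  obtain ⟨hi1, h1⟩ := integral_fderiv_smearedField hd hρ hη hE hF hφR (hsuppR'.trans hS)
  obtain ⟨hi2, h2⟩ := lintegral_enorm_sq_eq (aestronglyMeasurable_smearedField hd hρ hη hE R) hfin
  refine ⟨F.filter fun p ↦ Metric.closedBall p 2 ⊆ cube d R,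
    fun p hp ↦ (Finset.mem_filter.1 hp).2, ?_⟩
  have hsum : ∑ q ∈ F, (N q : ℝ) * ∫ x, μ (x - q) * φ (R⁻¹ • x) ≤
      ∑ p ∈ F.filter fun p ↦ Metric.closedBall p 2 ⊆ cube d R, (N p : ℝ) := by
    rw [Finset.sum_filter]
    refine Finset.sum_le_sum fun q _ ↦ ?_
    split_ifs with hq
    · refine mul_le_of_le_one_right (Nat.cast_nonneg _) ?_
      calc _ ≤ ∫ x, μ (x - q) := by
            refine integral_mono ((hμ.integrable.comp_sub_right q).mul_bdd (c := 1)
              hφR.continuous.aestronglyMeasurable (ae_of_all _ fun x ↦ ?_))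
              (hμ.integrable.comp_sub_right q) fun x ↦ mul_le_of_le_one_right (hμ.nonneg _) (hφ1 _)
            rw [Real.norm_of_nonneg (hφ0 _)]
            exact hφ1 _
        _ = 1 := by rw [integral_sub_right_eq_self μ q, hμ.integral_eq_one]
    -- If the smeared charge at `q` met the support of the cutoff, then `q` would lie in the cube of
    -- half-side `R * b + η`, and the ball of radius `2` around it would fit in `K_R` by `hbR`.
    · rw [integral_eq_zero_of_ae, mul_zero]
      refine ae_of_all _ fun x ↦ ?_
      by_contra hne
      have h3 : φ (R⁻¹ • x) ≠ 0 := right_ne_zero_of_mul hne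
      have h4 := hsuppR (subset_tsupport (fun x ↦ φ (R⁻¹ • x)) h3)
      have h5 : ‖x - q‖ ≤ η := by
        by_contra h
        exact left_ne_zero_of_mul hne (hμ.eq_zero (not_le.1 h))
      refine hq fun y hy i ↦ ?_
      rw [mem_closedBall_iff_norm] at hy
      have h6 : |y i - q i| ≤ 2 := (PiLp.norm_apply_le (y - q) i).trans hy
      have h7 : |x i - q i| ≤ η := (PiLp.norm_apply_le (x - q) i).trans h5
      have h8 := h4 i
      rw [abs_le] at h6 h7 h8 ⊢
      constructor <;> linarith
  have hint : ∫ x, φ (R⁻¹ • x) = R ^ d * ∫ x, φ x := by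
    rw [Measure.integral_comp_inv_smul_of_nonneg _ _ hR.le, finrank_euclideanSpace_fin, smul_eq_mul]
  have hfd : ∀ x, ‖fderiv ℝ (fun x ↦ φ (R⁻¹ • x)) x‖ ≤ M / R := fun x ↦ by
    rw [fderiv_comp_smul, norm_smul, Real.norm_of_nonneg (inv_nonneg.2 hR.le),
      inv_mul_eq_div]
    gcongr
    exact hM _
  -- The gradient of the rescaled cutoff is at most `M / R`, and `t ≤ 1 + t²` bounds the field by
  -- volume plus energy.
  have hlow : -(M / R * ((2 * R) ^ d + (∫⁻ x in cube d R, ‖smearedField ρ η E N x‖ₑ ^ 2).toReal)) ≤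
      ∫ x, fderiv ℝ (fun x ↦ φ (R⁻¹ • x)) x (smearedField ρ η E N x) := by
    have hzero : ∀ x, x ∉ cube d R → fderiv ℝ (fun x ↦ φ (R⁻¹ • x)) x = 0 := fun x hx ↦
      image_eq_zero_of_notMem_tsupport fun h ↦ hx (hsuppR' (tsupport_fderiv_subset ℝ h))
    have hi3 : IntegrableOn (fun _ : Space d ↦ (1 : ℝ)) (cube d R) :=
      integrableOn_const (isCompact_cube d R).measure_lt_top.ne
    have hone : ∫ x in cube d R, (1 : ℝ) = (2 * R) ^ d := by
      rw [setIntegral_const, measureReal_def, volume_cube d hR.le, ENNReal.toReal_ofReal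
        (by positivity)]
      simp
    rw [← h2, ← hone, ← integral_add hi3 hi2, ← integral_const_mul, ← integral_neg]
    rw [← setIntegral_eq_integral_of_forall_compl_eq_zero (s := cube d R) (μ := volume)
      (f := fun x ↦ fderiv ℝ (fun x ↦ φ (R⁻¹ • x)) x (smearedField ρ η E N x))
      (fun x hx ↦ by simp [hzero x hx])]
    refine integral_mono ((hi3.add hi2).const_mul _).neg hi1.integrableOn fun x ↦ ?_
    have h3 := (fderiv ℝ (fun x ↦ φ (R⁻¹ • x)) x).le_of_opNorm_le (hfd x) (smearedField ρ η E N x)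
    have h4 : M / R * ‖smearedField ρ η E N x‖ ≤ M / R * (1 + ‖smearedField ρ η E N x‖ ^ 2) := by
      refine mul_le_mul_of_nonneg_left ?_ (by positivity)
      nlinarith [sq_nonneg (‖smearedField ρ η E N x‖ - 1), norm_nonneg (smearedField ρ η E N x)]
    rw [Real.norm_eq_abs] at h3
    have h5 := (abs_le.1 (h3.trans h4)).1
    exact h5
  rw [h1, hint] at hlow
  set A := (2 * R) ^ d + (∫⁻ x in cube d R, ‖smearedField ρ η E N x‖ₑ ^ 2).toReal
  have h3 : M / (coulombConst d * R) * A = (M / R * A) / coulombConst d := by field_simp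
  rw [h3]
  have h4 : -(M / R * A) / coulombConst d ≤
      (∑ q ∈ F, (N q : ℝ) * ∫ x, μ (x - q) * φ (R⁻¹ • x)) - R ^ d * ∫ x, φ x := by
    rw [div_le_iff₀ hc]
    linarith
  rw [neg_div] at h4
  linarith

/-! ### The lower bound on the energy density. -/

/-- The energy per unit volume is at least `c_d D(δ^{(η)}, δ^{(η)})` up to a constant. -/
lemma limsup_energy_ge {d : ℕ} (hd : 2 ≤ d) {ρ : Space d → ℝ}
    (hρ : IsSmearingProfile ρ) {η : ℝ} (hη : 0 < η) {E : Space d → Space d} {N : Space d → ℕ}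
    (hE : IsAdmissibleField 1 E N) :
    ENNReal.ofReal (coulombConst d *
      (coulombInteraction d (smearedCharge ρ η) (smearedCharge ρ η) -
        (coulombProfile d 1 + 2 + 2 * kernelExcess d))) ≤
      limsup (fun R : ℝ ↦ (∫⁻ x in cube d R, ‖smearedField ρ η E N x‖ₑ ^ 2) / volume (cube d R))
        atTop := by
  have hμ := isRadialDensity_smearedCharge hρ hη
  obtain ⟨χ, hχ, hχ', hD⟩ := hμ.exists_mollifier_interaction_le hd
    (interaction_smearedCharge hd hρ hη).1
  have hψ := hμ.mollify hχ hχ'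
  have hψ' := hμ.isTestFunction_mollify hχ
  have hg := hψ.isTestFunction_cellFunction hd hψ'
  have hgint := hψ.integral_cellFunction_le hd hψ'
  have hc := coulombConst_pos hd
  set ψ := mollify χ (smearedCharge ρ η)
  set K := coulombConst d * (coulombInteraction d (smearedCharge ρ η) (smearedCharge ρ η) -
        (coulombProfile d 1 + 2 + 2 * kernelExcess d))
  by_contra! hlt
  -- If `K ≤ 0` the left side is zero and there is nothing to prove; positivity is needed to
  -- multiply `K` by a lower bound on the number of charges.
  have hK : 0 < K := by
    by_contra h
    rw [ENNReal.ofReal_eq_zero.2 (not_lt.1 h)] at hlt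
    exact not_lt_zero hlt
  obtain ⟨l', hl1, hl2⟩ := exists_between hlt
  obtain ⟨l, hl0, rfl⟩ : ∃ l : ℝ, 0 ≤ l ∧ ENNReal.ofReal l = l' :=
    ⟨l'.toReal, ENNReal.toReal_nonneg, ENNReal.ofReal_toReal (hl2.trans_le le_top).ne⟩
  have hlK : l < K := (ENNReal.ofReal_lt_ofReal_iff hK).1 hl2
  have hev := eventually_lt_of_limsup_lt hl1
  -- Charges are counted in a cube smaller by a factor close to `a`; the lost volume must not close
  -- the gap between `l` and `K`.
  obtain ⟨a, ha0, ha1, haK⟩ : ∃ a : ℝ, 0 < a ∧ a < 1 ∧ l < K * a ^ d := by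
    have h1 : Tendsto (fun a : ℝ ↦ K * a ^ d) (nhdsWithin 1 (Set.Iio 1)) (nhds (K * 1 ^ d)) :=
      ((continuous_const.mul (continuous_pow d)).tendsto (1 : ℝ)).mono_left nhdsWithin_le_nhds
    rw [one_pow, mul_one] at h1
    have h2 : ∀ᶠ a : ℝ in nhdsWithin 1 (Set.Iio 1), 0 < a :=
      nhdsWithin_le_nhds (Ioi_mem_nhds one_pos)
    obtain ⟨a, ⟨h3, h4⟩, h5⟩ :=
      ((h1.eventually_const_lt hlK).and h2 |>.and self_mem_nhdsWithin).exists
    exact ⟨a, h4, h5, h3⟩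
  obtain ⟨φ, hφ, hφ0, hφ1, hsupp, hφint⟩ := exists_cube_cutoff d ha0
    (show a < (1 + a) / 2 by linarith)
  obtain ⟨M, hM⟩ := (hφ.2.fderiv ℝ).exists_bound_of_continuous
    ((hφ.contDiff_nat 1).continuous_fderiv (by simp))
  -- The assumed bound `l` on the energy density controls the error in the count of charges, each of
  -- which costs `K`. Letting `R → ∞` gives `K * a ^ d ≤ l`, against the choice of `a`.
  have hkey : ∀ᶠ R : ℝ in atTop, K * (a ^ d - M / coulombConst d * (1 + l) * R⁻¹) ≤ l := by
    filter_upwards [hev, eventually_gt_atTop 0,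
      eventually_ge_atTop ((η + 2) / (1 - (1 + a) / 2))] with R hR hR0 hRη
    have hbR : R * ((1 + a) / 2) + η + 2 ≤ R := by
      rw [div_le_iff₀ (by linarith)] at hRη
      linarith
    have hV : (0 : ℝ) < (2 * R) ^ d := by positivity
    rw [volume_cube d hR0.le, ENNReal.div_lt_iff (Or.inl (by simpa using hV))
      (Or.inl ENNReal.ofReal_ne_top), ← ENNReal.ofReal_mul hl0] at hR
    have hfin : ∫⁻ x in cube d R, ‖smearedField ρ η E N x‖ₑ ^ 2 ≠ ⊤ := (hR.trans_le le_top).ne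
    have hA : (∫⁻ x in cube d R, ‖smearedField ρ η E N x‖ₑ ^ 2).toReal ≤ l * (2 * R) ^ d :=
      ENNReal.toReal_le_of_le_ofReal (by positivity) hR.le
    obtain ⟨P, hP, hn⟩ := charge_number_ge hd hρ hη hE hφ hφ0 hφ1 hsupp hM hR0 hbR hfin
    have hen := charge_mul_le_energy hd hρ hη hE P hP hfin hχ hχ' hg
      (cellFunction_nonneg ψ) (hψ.tsupport_cellFunction hd)
      (fun φ hφ hφ0 ↦ integral_fderiv_gradient_cellFunction_le hd hψ' hψ.nonneg hφ hφ0)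
    have hKle : K ≤ coulombConst d * ((∫ x, ψ x * cellFunction ψ x) -
        2 * ∫ x, cellFunction ψ x) := by
      refine mul_le_mul_of_nonneg_left ?_ hc.le
      linarith
    have hn0 : 0 ≤ ∑ p ∈ P, (N p : ℝ) := Finset.sum_nonneg fun _ _ ↦ Nat.cast_nonneg _
    have hM0 : 0 ≤ M := (norm_nonneg _).trans (hM 0)
    have h1 : (a ^ d - M / coulombConst d * (1 + l) * R⁻¹) * (2 * R) ^ d ≤
        ∑ p ∈ P, (N p : ℝ) := by
      refine le_trans ?_ hn
      have h2 : R ^ d * (2 * a) ^ d ≤ R ^ d * ∫ x, φ x :=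
        mul_le_mul_of_nonneg_left hφint (by positivity)
      have h3 : M / (coulombConst d * R) * ((2 * R) ^ d +
          (∫⁻ x in cube d R, ‖smearedField ρ η E N x‖ₑ ^ 2).toReal) ≤
          M / (coulombConst d * R) * ((2 * R) ^ d + l * (2 * R) ^ d) := by
        gcongr
      have h4 : (a ^ d - M / coulombConst d * (1 + l) * R⁻¹) * (2 * R) ^ d =
          R ^ d * (2 * a) ^ d - M / (coulombConst d * R) * ((2 * R) ^ d + l * (2 * R) ^ d) := by
        rw [mul_pow, mul_pow]
        field_simp
      linarith
    have h5 : K * (a ^ d - M / coulombConst d * (1 + l) * R⁻¹) * (2 * R) ^ d ≤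
        l * (2 * R) ^ d := by
      calc _ = (a ^ d - M / coulombConst d * (1 + l) * R⁻¹) * (2 * R) ^ d * K := by ring
        _ ≤ (∑ p ∈ P, (N p : ℝ)) * K := mul_le_mul_of_nonneg_right h1 hK.le
        _ ≤ _ := (mul_le_mul_of_nonneg_left hKle hn0).trans (hen.trans hA)
    exact le_of_mul_le_mul_right h5 hV
  have hlim : Tendsto (fun R : ℝ ↦ K * (a ^ d - M / coulombConst d * (1 + l) * R⁻¹)) atTop
      (nhds (K * (a ^ d - M / coulombConst d * (1 + l) * 0))) :=
    ((tendsto_inv_atTop_zero.const_mul _).const_sub _).const_mul _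
  have := le_of_tendsto hlim hkey
  rw [mul_zero, sub_zero] at this
  linarith

theorem proposition4p1 (d : ℕ) (hd : 2 ≤ d) :
    ∃ C : ℝ, ∀ ρ : Space d → ℝ, IsSmearingProfile ρ → ∀ η : ℝ, 0 < η →
      ∀ (E : Space d → Space d) (N : Space d → ℕ), IsAdmissibleField 1 E N →
        ((-C : ℝ) : EReal) ≤ smearedEnergy ρ η 1 E N := by
  refine ⟨coulombConst d * (coulombProfile d 1 + 2 + 2 * kernelExcess d),
    fun ρ hρ η hη E N hE ↦ ?_⟩
  have h := limsup_energy_ge hd hρ hη hE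
  unfold smearedEnergy
  rw [mul_sub, coulombConst_mul_interaction hd hρ hη] at h
  set L := limsup (fun R : ℝ ↦
    (∫⁻ x in cube d R, ‖smearedField ρ η E N x‖ₑ ^ 2) / volume (cube d R)) atTop
  rw [one_mul]
  rcases eq_or_ne L ⊤ with hL | hL
  · rw [hL, EReal.coe_ennreal_top, EReal.top_sub_coe]
    exact le_top
  · lift L to NNReal using hL with l
    rw [ENNReal.ofReal_le_coe] at h
    have h1 : ((l : ENNReal) : EReal) = ((l : ℝ) : EReal) := rfl
    rw [h1, ← EReal.coe_sub, EReal.coe_le_coe_iff]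
    linarith

end
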